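/- Let $\mathsf{AtProp}$ and $\mathsf{AtRes}$ be disjoint sets (of atomic propositions and atomic resources). Resource terms and formulas of the logic of resources and capabilities LRC are given by $$\alpha ::= a\mid 1\mid 0\mid \alpha\cdot\alpha\mid\alpha\sqcup\alpha\mid\alpha\sqcap\alpha,\qquad A ::= p\mid\top\mid\bot\mid A\vee A\mid A\wedge A\mid A\to A\mid \alpha\vartriangleright A\mid\Diamond A\mid \Diamond_{r}\alpha\mid\alpha\vartriangleright_{r}\alpha,$$ with $a\in\mathsf{AtRes}$, $p\in\mathsf{AtProp}$. *Resource entailment* $\alpha\vdash\beta$ is the least preorder on resource terms for which $\sqcap$ and $\sqcup$ are meet and join, these distribute over each other, $1$ is greatest and $0$ least, $\cdot$ is associative with unit $1$ (up to $\dashv\vdash$), $\alpha\cdot(\beta\sqcup\gamma)\vdash(\alpha\cdot\beta)\sqcup(\alpha\cdot\gamma)$ and $(\beta\sqcup\gamma)\cdot\alpha\vdash(\beta\cdot\alpha)\sqcup(\gamma\cdot\alpha)$, and which is closed under: $\alpha\vdash\beta$ implies $\alpha\cdot\gamma\vdash\beta\cdot\gamma$ and $\gamma\cdot\alpha\vdash\gamma\cdot\beta$.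 The *Hilbert calculus* of LRC has as axioms those of intuitionistic propositional logic and all instances of $\Diamond(A\vee B)\leftrightarrow\Diamond A\vee\Diamond B$; $\Diamond\bot\leftrightarrow\bot$; $\Diamond_r(\alpha\sqcup\beta)\leftrightarrow\Diamond_r\alpha\vee\Diamond_r\beta$; $\Diamond_r0\leftrightarrow\bot$; $(\alpha\sqcup\beta)\vartriangleright A\leftrightarrow(\alpha\vartriangleright A)\wedge(\beta\vartriangleright A)$; $0\vartriangleright A$; $\alpha\vartriangleright(\beta\vartriangleright A)\to(\alpha\cdot\beta)\vartriangleright A$; $(\alpha\sqcup\beta)\vartriangleright_r\gamma\leftrightarrow(\alpha\vartriangleright_r\gamma)\wedge(\beta\vartriangleright_r\gamma)$; $0\vartriangleright_r\alpha$; $\alpha\vartriangleright_r(\beta\sqcap\gamma)\leftrightarrow(\alpha\vartriangleright_r\beta)\wedge(\alpha\vartriangleright_r\gamma)$; $\alpha\vartriangleright_r1$; $\Diamond_r\alpha\wedge(\alpha\vartriangleright A)\to\Diamond A$; $(\alpha\vartriangleright_r\beta)\to(\alpha\vartriangleright\Diamond_r\beta)$. Its rules are modus ponens, uniform substitution (applied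 to theorems), and: from $A\vdash B$ infer $\alpha\vartriangleright A\vdash\alpha\vartriangleright B$ and $\Diamond A\vdash\Diamond B$; from $\alpha\vdash\beta$ infer $\beta\vartriangleright A\vdash\alpha\vartriangleright A$, $\Diamond_r\alpha\vdash\Diamond_r\beta$, $\gamma\vartriangleright_r\alpha\vdash\gamma\vartriangleright_r\beta$ and $\beta\vartriangleright_r\gamma\vdash\alpha\vartriangleright_r\gamma$. For a set $X$ of formulas, $X\vdash A$ means that $A$ has a proof which may use members of $X$ as assumptions; $A\vdash B$ abbreviates $\{A\}\vdash B$, and an inferred $A'\vdash B'$ may be used as the theorem $A'\to B'$. A *heterogeneous LRC-algebra* $F$ consists of a Heyting algebra $\mathbb A$, a bounded distributive lattice $\mathbb Q$ with bottom $0$ and top $1$, an associative operation $\cdot$ on $\mathbb Q$ with unit $1$ preserving finite joins in each coordinate, and maps $\vartriangleright:\mathbb Q\times\mathbb A\to\mathbb A$, $\Diamond:\mathbb A\to\mathbb A$, $\vartriangleright_r:\mathbb Q\times\mathbb Q\to\mathbb A$, $\Diamond_r:\mathbb Q\to\mathbb A$ that satisfy the (in)equalities and quasi-inequalities corresponding to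 the axioms and rules above. It is *perfect* if $\mathbb A$ and $\mathbb Q$ are complete, completely distributive, and every element is a join of completely join-irreducible elements; $\cdot$ preserves arbitrary joins in each coordinate; $\Diamond$ and $\Diamond_r$ preserve arbitrary joins; $\vartriangleright$ and $\vartriangleright_r$ turn arbitrary joins in the first coordinate into meets; and $\vartriangleright_r$ preserves arbitrary meets in the second coordinate. Assignments $v:\mathsf{AtProp}\to\mathbb A$, $w:\mathsf{AtRes}\to\mathbb Q$ extend homomorphically to all terms; write $[\![\cdot]\!]$ for the extension. **Theorem (strong completeness).** For every set $X$ of formulas and every formula $A$: $X\vdash A$ if and only if $\bigwedge_{B\in X}[\![B]\!]\le[\![A]\!]$ for all perfect heterogeneous LRC-algebras and all assignments into them. Likewise, for all resource terms $\alpha,\beta$: $\alpha\vdash\beta$ if and only if $[\![\alpha]\!]\le[\![\beta]\!]$ for all perfect heterogeneous LRC-algebras and all assignments into them. -/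

import Mathlib

universe u

namespace LRC

/-- Resource terms over a set `R` of atomic resources:
`α ::= a | 1 | 0 | α · α | α ⊔ α | α ⊓ α`. -/
inductive Res (R : Type u) : Type u
  | atom : R → Res R
  | one : Res R
  | zero : Res R
  | mul : Res R → Res R → Res R
  | sup : Res R → Res R → Res R
  | inf : Res R → Res R → Res R

/-- Formula terms over atomic propositions `P` and atomic resources `R`:
`A ::= p | ⊤ | ⊥ | A ∨ A | A ∧ A | A → A | α ▷ A | ◇ A | ◇ᵣ α | α ▷ᵣ α`.
The four modal connectives are called `use` (`▷`), `dia` (`◇`), `have_` (`◇ᵣ`: possession of a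
resource) and `get` (`▷ᵣ`: getting a resource from a resource). -/
inductive Fm (P R : Type u) : Type u
  | atom : P → Fm P R
  | top : Fm P R
  | bot : Fm P R
  | or : Fm P R → Fm P R → Fm P R
  | and : Fm P R → Fm P R → Fm P R
  | imp : Fm P R → Fm P R → Fm P R
  | use : Res R → Fm P R → Fm P R
  | dia : Fm P R → Fm P R
  | have_ : Res R → Fm P R
  | get : Res R → Res R → Fm P R

/-- `A ↔ B`. -/
def Fm.iff {P R : Type u} (A B : Fm P R) : Fm P R := .and (.imp A B) (.imp B A)

/-- Simultaneous substitution of resource terms for atomic resources. -/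
def Res.subst {R : Type u} (τ : R → Res R) : Res R → Res R
  | .atom a => τ a
  | .one => .one
  | .zero => .zero
  | .mul α β => .mul (α.subst τ) (β.subst τ)
  | .sup α β => .sup (α.subst τ) (β.subst τ)
  | .inf α β => .inf (α.subst τ) (β.subst τ)

/-- Uniform substitution of formulas for atomic propositions and of resource terms for atomic
resources. -/
def Fm.subst {P R : Type u} (σ : P → Fm P R) (τ : R → Res R) : Fm P R → Fm P R
  | .atom p => σ p
  | .top => .top
  | .bot => .bot
  | .or A B => .or (A.subst σ τ) (B.subst σ τ)
  | .and A B => .and (A.subst σ τ) (B.subst σ τ)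
  | .imp A B => .imp (A.subst σ τ) (B.subst σ τ)
  | .use α A => .use (α.subst τ) (A.subst σ τ)
  | .dia A => .dia (A.subst σ τ)
  | .have_ α => .have_ (α.subst τ)
  | .get α β => .get (α.subst τ) (β.subst τ)

/-- Entailment `α ⊢ β` between resource terms: a preorder for which `⊓` is the meet and `⊔` the
join, satisfying the schemas R1 - R4 and closed under MF and MF'. -/
inductive ResEntails {R : Type u} : Res R → Res R → Prop
  | refl (α) : ResEntails α α
  | trans {α β γ} : ResEntails α β → ResEntails β γ → ResEntails α γ
  | inf_left (α β) : ResEntails (.inf α β) α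
  | inf_right (α β) : ResEntails (.inf α β) β
  | le_inf {α β γ} : ResEntails γ α → ResEntails γ β → ResEntails γ (.inf α β)
  | left_sup (α β) : ResEntails α (.sup α β)
  | right_sup (α β) : ResEntails β (.sup α β)
  | sup_le {α β γ} : ResEntails α γ → ResEntails β γ → ResEntails (.sup α β) γ
  -- R1: `⊓` and `⊔` distribute over each other; the other parts of R1 (commutativity,
  -- associativity, idempotence) are instances of the lattice clauses above.
  | R1_inf_sup (α β γ) :
      ResEntails (.inf α (.sup β γ)) (.sup (.inf α β) (.inf α γ))
  | R1_sup_inf (α β γ) :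
      ResEntails (.inf (.sup α β) (.sup α γ)) (.sup α (.inf β γ))
  -- R2: `·` is associative with unit `1`
  | R2_assoc (α β γ) : ResEntails (.mul (.mul α β) γ) (.mul α (.mul β γ))
  | R2_assoc' (α β γ) : ResEntails (.mul α (.mul β γ)) (.mul (.mul α β) γ)
  | R2_one_mul (α) : ResEntails (.mul .one α) α
  | R2_one_mul' (α) : ResEntails α (.mul .one α)
  | R2_mul_one (α) : ResEntails (.mul α .one) α
  | R2_mul_one' (α) : ResEntails α (.mul α .one)
  | R3_one (α) : ResEntails α .one
  | R3_zero (α) : ResEntails .zero α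
  | R4_left (α β γ) : ResEntails (.mul α (.sup β γ)) (.sup (.mul α β) (.mul α γ))
  | R4_right (α β γ) : ResEntails (.mul (.sup β γ) α) (.sup (.mul β α) (.mul γ α))
  | MF {α β} (γ) : ResEntails α β → ResEntails (.mul α γ) (.mul β γ)
  | MF' {α β} (γ) : ResEntails α β → ResEntails (.mul γ α) (.mul γ β)

/-- The axioms of the Hilbert calculus of LRC. -/
inductive IsAxiom {P R : Type u} : Fm P R → Prop
  -- intuitionistic propositional logic
  | imp_K (A B) : IsAxiom (.imp A (.imp B A))
  | imp_S (A B C) :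
      IsAxiom (.imp (.imp A (.imp B C)) (.imp (.imp A B) (.imp A C)))
  | and_left (A B) : IsAxiom (.imp (.and A B) A)
  | and_right (A B) : IsAxiom (.imp (.and A B) B)
  | and_intro (A B) : IsAxiom (.imp A (.imp B (.and A B)))
  | or_left (A B) : IsAxiom (.imp A (.or A B))
  | or_right (A B) : IsAxiom (.imp B (.or A B))
  | or_elim (A B C) :
      IsAxiom (.imp (.imp A C) (.imp (.imp B C) (.imp (.or A B) C)))
  | bot_elim (A) : IsAxiom (.imp .bot A)
  | top_intro : IsAxiom .top
  -- axioms for `◇` and `◇ᵣ`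
  | D1 (A B) : IsAxiom (.iff (.dia (.or A B)) (.or (.dia A) (.dia B)))
  | D2 : IsAxiom (.iff (.dia .bot) .bot)
  | D3 (α β) : IsAxiom (.iff (.have_ (.sup α β)) (.or (.have_ α) (.have_ β)))
  | D4 : IsAxiom (.iff (.have_ .zero) .bot)
  -- axioms for `▷` and `▷ᵣ`
  | B1 (α β A) : IsAxiom (.iff (.use (.sup α β) A) (.and (.use α A) (.use β A)))
  | B2 (A) : IsAxiom (.use .zero A)
  | B3 (α β A) : IsAxiom (.imp (.use α (.use β A)) (.use (.mul α β) A))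
  | B4 (α β γ) : IsAxiom (.iff (.get (.sup α β) γ) (.and (.get α γ) (.get β γ)))
  | B5 (α) : IsAxiom (.get .zero α)
  | B6 (α β γ) : IsAxiom (.iff (.get α (.inf β γ)) (.and (.get α β) (.get α γ)))
  | B7 (α) : IsAxiom (.get α .one)
  -- interaction axioms
  | BD1 (α A) : IsAxiom (.imp (.and (.have_ α) (.use α A)) (.dia A))
  | BD2 (α β) : IsAxiom (.imp (.get α β) (.use α (.have_ β)))

/-- `Derives X A`, i.e. `X ⊢ A`: there is a proof of `A` in the Hilbert calculus of LRC which
possibly uses formulas of `X` as assumptions. The theorems of LRC are the formulas `A` with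
`Derives ∅ A`. Uniform substitution applies to theorems only, and a rule `A ⊢ B / A' ⊢ B'` may be
applied when `B` has been derived from the single assumption `A`; its conclusion `A' ⊢ B'` is
recorded as the theorem `A' → B'`. -/
inductive Derives {P R : Type u} : Set (Fm P R) → Fm P R → Prop
  | hyp {X A} : A ∈ X → Derives X A
  | ax {X A} : IsAxiom A → Derives X A
  | mp {X A B} : Derives X (.imp A B) → Derives X A → Derives X B
  | subst {X A} (σ : P → Fm P R) (τ : R → Res R) : Derives ∅ A → Derives X (A.subst σ τ)
  | MB {X A B} (α) : Derives {A} B → Derives X (.imp (.use α A) (.use α B))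
  | MD {X A B} : Derives {A} B → Derives X (.imp (.dia A) (.dia B))
  | AB {X α β} (A) : ResEntails α β → Derives X (.imp (.use β A) (.use α A))
  | MD' {X α β} : ResEntails α β → Derives X (.imp (.have_ α) (.have_ β))
  | MB' {X α β} (γ) : ResEntails α β → Derives X (.imp (.get γ α) (.get γ β))
  | AB' {X α β} (γ) : ResEntails α β → Derives X (.imp (.get β γ) (.get α γ))

/-- A heterogeneous LRC-algebra on a Heyting algebra `𝔸` and a bounded distributive lattice `Q`
(whose top element is the unit `1` of `·` and whose bottom element is `0`). -/
structure HetAlgebra (𝔸 Q : Type u) [HeytingAlgebra 𝔸] [DistribLattice Q] [BoundedOrder Q] where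
  /-- `· : Q × Q → Q` -/
  mul : Q → Q → Q
  /-- `▷ : Q × 𝔸 → 𝔸` -/
  use : Q → 𝔸 → 𝔸
  /-- `◇ : 𝔸 → 𝔸` -/
  dia : 𝔸 → 𝔸
  /-- `◇ᵣ : Q → 𝔸` -/
  have_ : Q → 𝔸
  /-- `▷ᵣ : Q × Q → 𝔸` -/
  get : Q → Q → 𝔸
  mul_assoc : ∀ α β γ, mul (mul α β) γ = mul α (mul β γ)
  top_mul : ∀ α, mul ⊤ α = α
  mul_top : ∀ α, mul α ⊤ = α
  mul_sup : ∀ α β γ, mul α (β ⊔ γ) = mul α β ⊔ mul α γ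
  sup_mul : ∀ α β γ, mul (β ⊔ γ) α = mul β α ⊔ mul γ α
  mul_bot : ∀ α, mul α ⊥ = ⊥
  bot_mul : ∀ α, mul ⊥ α = ⊥
  D1 : ∀ a b, dia (a ⊔ b) = dia a ⊔ dia b
  D2 : dia ⊥ = ⊥
  D3 : ∀ α β, have_ (α ⊔ β) = have_ α ⊔ have_ β
  D4 : have_ ⊥ = ⊥
  B1 : ∀ α β a, use (α ⊔ β) a = use α a ⊓ use β a
  B2 : ∀ a, use ⊥ a = ⊤
  B3 : ∀ α β a, use α (use β a) ≤ use (mul α β) a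
  B4 : ∀ α β γ, get (α ⊔ β) γ = get α γ ⊓ get β γ
  B5 : ∀ α, get ⊥ α = ⊤
  B6 : ∀ α β γ, get α (β ⊓ γ) = get α β ⊓ get α γ
  B7 : ∀ α, get α ⊤ = ⊤
  BD1 : ∀ α a, have_ α ⊓ use α a ≤ dia a
  BD2 : ∀ α β, get α β ≤ use α (have_ β)
  MF : ∀ α β γ, α ≤ β → mul α γ ≤ mul β γ
  MF' : ∀ α β γ, α ≤ β → mul γ α ≤ mul γ β
  MB : ∀ α a b, a ≤ b → use α a ≤ use α b
  MD : ∀ a b, a ≤ b → dia a ≤ dia b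
  AB : ∀ α β a, α ≤ β → use β a ≤ use α a
  MD' : ∀ α β, α ≤ β → have_ α ≤ have_ β
  MB' : ∀ α β γ, α ≤ β → get γ α ≤ get γ β
  AB' : ∀ α β γ, α ≤ β → get β γ ≤ get α γ

/-- An element of a complete lattice is completely join-irreducible if it belongs to every set of
which it is the join (so it is not `⊥`, the join of the empty set). -/
def CompletelyJoinIrreducible {L : Type u} [CompleteLattice L] (j : L) : Prop :=
  ∀ S : Set L, j = sSup S → j ∈ S

/-- A (complete and) completely distributive lattice is perfect if every element is a join of
completely join-irreducible elements. -/
def IsPerfectLattice (L : Type u) [CompletelyDistribLattice L] : Prop :=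
  ∀ a : L, ∃ S : Set L, (∀ j ∈ S, CompletelyJoinIrreducible j) ∧ a = sSup S

namespace HetAlgebra

/-- A heterogeneous LRC-algebra is perfect if both of its lattices are perfect and its operations
have the infinitary versions of their join- and meet-preservation properties. -/
structure IsPerfect {𝔸 Q : Type u} [CompletelyDistribLattice 𝔸] [CompletelyDistribLattice Q]
    (F : HetAlgebra 𝔸 Q) : Prop where
  perfect_fm : IsPerfectLattice 𝔸
  perfect_res : IsPerfectLattice Q
  mul_sSup : ∀ (α : Q) (S : Set Q), F.mul α (sSup S) = ⨆ β ∈ S, F.mul α β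
  sSup_mul : ∀ (S : Set Q) (α : Q), F.mul (sSup S) α = ⨆ β ∈ S, F.mul β α
  dia_sSup : ∀ S : Set 𝔸, F.dia (sSup S) = ⨆ a ∈ S, F.dia a
  have_sSup : ∀ S : Set Q, F.have_ (sSup S) = ⨆ α ∈ S, F.have_ α
  use_sSup : ∀ (S : Set Q) (a : 𝔸), F.use (sSup S) a = ⨅ α ∈ S, F.use α a
  get_sSup : ∀ (S : Set Q) (β : Q), F.get (sSup S) β = ⨅ α ∈ S, F.get α β
  get_sInf : ∀ (α : Q) (S : Set Q), F.get α (sInf S) = ⨅ β ∈ S, F.get α β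

section

variable {P R 𝔸 Q : Type u} [HeytingAlgebra 𝔸] [DistribLattice Q] [BoundedOrder Q]

/-- The homomorphic extension of an assignment `w` of the atomic resources. -/
def evalRes (F : HetAlgebra 𝔸 Q) (w : R → Q) : Res R → Q
  | .atom a => w a
  | .one => ⊤
  | .zero => ⊥
  | .mul α β => F.mul (F.evalRes w α) (F.evalRes w β)
  | .sup α β => F.evalRes w α ⊔ F.evalRes w β
  | .inf α β => F.evalRes w α ⊓ F.evalRes w β

/-- The homomorphic extension of assignments `v` of the atomic propositions and `w` of the atomic
resources. -/
def evalFm (F : HetAlgebra 𝔸 Q) (v : P → 𝔸) (w : R → Q) : Fm P R → 𝔸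
  | .atom p => v p
  | .top => ⊤
  | .bot => ⊥
  | .or A B => F.evalFm v w A ⊔ F.evalFm v w B
  | .and A B => F.evalFm v w A ⊓ F.evalFm v w B
  | .imp A B => F.evalFm v w A ⇨ F.evalFm v w B
  | .use α A => F.use (F.evalRes w α) (F.evalFm v w A)
  | .dia A => F.dia (F.evalFm v w A)
  | .have_ α => F.have_ (F.evalRes w α)
  | .get α β => F.get (F.evalRes w α) (F.evalRes w β)

end

end HetAlgebra

/-- `X ⊨ A` over perfect heterogeneous LRC-algebras: in every model on such an algebra, the meet
of the values of the formulas in `X` is below the value of `A`. -/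
def PerfectEntails {P R : Type u} (X : Set (Fm P R)) (A : Fm P R) : Prop :=
  ∀ (𝔸 Q : Type u) [CompletelyDistribLattice 𝔸] [CompletelyDistribLattice Q]
    (F : HetAlgebra 𝔸 Q), F.IsPerfect → ∀ (v : P → 𝔸) (w : R → Q),
      ⨅ B ∈ X, F.evalFm v w B ≤ F.evalFm v w A

/-- `α ⊨ β` over perfect heterogeneous LRC-algebras, for resource terms. -/
def PerfectResEntails {R : Type u} (α β : Res R) : Prop :=
  ∀ (𝔸 Q : Type u) [CompletelyDistribLattice 𝔸] [CompletelyDistribLattice Q]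
    (F : HetAlgebra 𝔸 Q), F.IsPerfect → ∀ w : R → Q, F.evalRes w α ≤ F.evalRes w β

end LRC

/-! ### Prime filters and separation -/

namespace LRC

/-! Soundness is an induction on derivations. Completeness combines a Lindenbaum algebra with a
canonical extension. Formulas and resource terms modulo interderivability form a heterogeneous
LRC-algebra (`lindenbaum`) whose order is derivability, but which need not be perfect. Every
heterogeneous LRC-algebra embeds into a perfect one (`canonicalExtension`), so a refutation in the
former becomes one in the latter.

The perfect algebra consists of the sets of prime filters closed under enlargement, and `a` is sent
to the set of prime filters containing it. Since prime filters are ordered by reverse inclusion,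
these are the lower sets. `·`, `◇` and `◇ᵣ` extend through relations such as `k · l ⊆ j`, and
therefore preserve all joins. `▷` is only monotone in its second coordinate, so no relation on
points describes it; it is extended by approximating that argument from above by ideals. `▷ᵣ`
preserves meets there, so complements of prime filters suffice as approximants.

All the work lies in separation: a filter base and an ideal base with no element of the first below
one of the second are separated by a prime filter (`exists_separating`). This shows that the
embedding preserves the operations and that associativity and the interaction axioms survive. For an
arbitrary `X`, the consequences of `X` form a filter in the Lindenbaum algebra; a prime filter
containing it and omitting `A` is a point of the intersection that interprets `X`, but not of the
interpretation of `A`. -/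

/-- Prime filters of a bounded lattice. -/
structure PrimeFilter (L : Type u) [Lattice L] [BoundedOrder L] where
  /-- The elements of the filter. -/
  carrier : Set L
  up : ∀ {a b : L}, a ≤ b → a ∈ carrier → b ∈ carrier
  inf_mem : ∀ {a b : L}, a ∈ carrier → b ∈ carrier → a ⊓ b ∈ carrier
  top_mem : ⊤ ∈ carrier
  bot_notMem : ⊥ ∉ carrier
  mem_or_mem : ∀ {a b : L}, a ⊔ b ∈ carrier → a ∈ carrier ∨ b ∈ carrier

namespace PrimeFilter

section Lattice

variable {L : Type u} [Lattice L] [BoundedOrder L]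

instance : Membership L (PrimeFilter L) := ⟨fun p a => a ∈ p.carrier⟩

/-- Prime filters are ordered by reverse inclusion. -/
instance : PartialOrder (PrimeFilter L) where
  le p q := ∀ a : L, a ∈ q → a ∈ p
  le_refl _ _ h := h
  le_trans _ _ _ h h' a ha := h a (h' a ha)
  le_antisymm p q h h' := by
    cases p; cases q
    congr
    exact Set.Subset.antisymm h' h

variable (p : PrimeFilter L) {a b : L}

theorem mem_of_le (h : a ≤ b) (ha : a ∈ p) : b ∈ p := p.up h ha

theorem mem_inf_iff : a ⊓ b ∈ p ↔ a ∈ p ∧ b ∈ p :=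
  ⟨fun h => ⟨p.up inf_le_left h, p.up inf_le_right h⟩, fun h => p.inf_mem h.1 h.2⟩

theorem mem_sup_iff : a ⊔ b ∈ p ↔ a ∈ p ∨ b ∈ p :=
  ⟨p.mem_or_mem, fun h => h.elim (p.up le_sup_left) (p.up le_sup_right)⟩

theorem mem_top : (⊤ : L) ∈ p := p.top_mem

theorem notMem_bot : (⊥ : L) ∉ p := p.bot_notMem

end Lattice

variable {L : Type u} [DistribLattice L] [BoundedOrder L]

/-- The prime filter theorem, for a filter base `F` and an ideal base `I`. -/
theorem exists_separating {F I : Set L} (hF : F.Nonempty) (hI : I.Nonempty)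
    (F_inf : ∀ a ∈ F, ∀ b ∈ F, a ⊓ b ∈ F) (I_sup : ∀ a ∈ I, ∀ b ∈ I, a ⊔ b ∈ I)
    (disj : ∀ a ∈ F, ∀ b ∈ I, ¬ a ≤ b) :
    ∃ p : PrimeFilter L, (∀ a ∈ F, a ∈ p) ∧ ∀ a ∈ I, a ∉ p := by
  have hF' : Order.IsPFilter {a | ∃ x ∈ F, x ≤ a} := by
    refine Order.IsPFilter.of_def ?_ ?_ ?_
    · obtain ⟨x, hx⟩ := hF
      exact ⟨x, x, hx, le_rfl⟩
    · rintro a ⟨x, hx, hxa⟩ b ⟨y, hy, hyb⟩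
      exact ⟨x ⊓ y, ⟨_, F_inf x hx y hy, le_rfl⟩, inf_le_left.trans hxa, inf_le_right.trans hyb⟩
    · rintro a b hab ⟨x, hx, hxa⟩
      exact ⟨x, hx, hxa.trans hab⟩
  have hI' : Order.IsIdeal {a | ∃ x ∈ I, a ≤ x} := by
    refine ⟨?_, ?_, ?_⟩
    · rintro a b hab ⟨x, hx, hxa⟩
      exact ⟨x, hx, hab.trans hxa⟩
    · obtain ⟨x, hx⟩ := hI
      exact ⟨x, x, hx, le_rfl⟩
    · rintro a ⟨x, hx, hxa⟩ b ⟨y, hy, hyb⟩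
      exact ⟨x ⊔ y, ⟨_, I_sup x hx y hy, le_rfl⟩, hxa.trans le_sup_left, hyb.trans le_sup_right⟩
  have hd : Disjoint ((hF'.toPFilter : Order.PFilter L) : Set L) (hI'.toIdeal : Set L) := by
    rw [Set.disjoint_left]
    rintro a ⟨x, hx, hxa⟩ ⟨y, hy, hay⟩
    exact disj x hx y hy (hxa.trans hay)
  obtain ⟨J, hJ, hIJ, hFJ⟩ := DistribLattice.prime_ideal_of_disjoint_filter_ideal hd
  rw [Set.disjoint_left] at hFJ
  -- The complement of a prime ideal containing `I` and disjoint from `F` is the prime filter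
  -- sought.
  refine ⟨⟨{a | a ∉ J}, fun hab ha hb => ha (J.lower hab hb), fun ha hb hab => ?_, ?_,
    fun h => h J.bot_mem, fun {a b} hab => ?_⟩, fun a ha => hFJ ⟨a, ha, le_rfl⟩,
    fun a ha h => h (hIJ ⟨a, ha, le_rfl⟩)⟩
  · exact (hJ.mem_or_mem hab).elim ha hb
  · obtain ⟨x, hx⟩ := hF
    exact hFJ ⟨x, hx, le_top⟩
  · by_contra h
    simp only [Set.mem_ofPred_eq, not_or, not_not] at h
    exact hab (Order.Ideal.sup_mem h.1 h.2)

theorem exists_mem_of_notMem_ideal {a : L} {I : Set L} (hI : ⊥ ∈ I)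
    (I_sup : ∀ a ∈ I, ∀ b ∈ I, a ⊔ b ∈ I) (I_down : ∀ a b, a ≤ b → b ∈ I → a ∈ I) (ha : a ∉ I) :
    ∃ p : PrimeFilter L, a ∈ p ∧ ∀ b ∈ I, b ∉ p := by
  obtain ⟨p, h, h'⟩ := exists_separating (F := {a}) (I := I) ⟨a, rfl⟩ ⟨_, hI⟩
    (by rintro _ rfl _ rfl; simp) I_sup (by rintro _ rfl b hb h; exact ha (I_down _ _ h hb))
  exact ⟨p, h a rfl, h'⟩

theorem exists_notMem_of_notMem_filter {a : L} {F : Set L} (hF : ⊤ ∈ F)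
    (F_inf : ∀ a ∈ F, ∀ b ∈ F, a ⊓ b ∈ F) (F_up : ∀ a b, a ≤ b → a ∈ F → b ∈ F) (ha : a ∉ F) :
    ∃ p : PrimeFilter L, (∀ b ∈ F, b ∈ p) ∧ a ∉ p := by
  obtain ⟨p, h, h'⟩ := exists_separating (F := F) (I := {a}) ⟨_, hF⟩ ⟨a, rfl⟩ F_inf
    (by rintro _ rfl _ rfl; simp) (by rintro b hb _ rfl h; exact ha (F_up _ _ h hb))
  exact ⟨p, h, h' a rfl⟩

end PrimeFilter

/-! ### The lattice of lower sets of prime filters -/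

/-- The embedding of a bounded lattice into its canonical extension, the lattice of upward closed
sets of prime filters. -/
def toCanonical {L : Type u} [Lattice L] [BoundedOrder L] (a : L) : LowerSet (PrimeFilter L) where
  carrier := {p | a ∈ p}
  lower' _ _ h ha := h a ha

section toCanonical

variable {L : Type u} [Lattice L] [BoundedOrder L]

theorem toCanonical_top : toCanonical (⊤ : L) = ⊤ := by
  ext p
  exact iff_of_true p.mem_top trivial

theorem toCanonical_bot : toCanonical (⊥ : L) = ⊥ := by
  ext p
  exact iff_of_false p.notMem_bot id

theorem toCanonical_sup (a b : L) : toCanonical (a ⊔ b) = toCanonical a ⊔ toCanonical b := by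
  ext p
  exact p.mem_sup_iff

theorem toCanonical_inf (a b : L) : toCanonical (a ⊓ b) = toCanonical a ⊓ toCanonical b := by
  ext p
  exact p.mem_inf_iff

end toCanonical

/-- If `a ⇨ b ∉ w`, the filter generated by `w` and `a` misses `b`, so it extends to a prime filter
`u` containing `w` and `a` but not `b`. As `u ≤ w`, this `u` refutes the implication between lower
sets at `w`. -/
theorem toCanonical_himp {L : Type u} [HeytingAlgebra L] (a b : L) :
    toCanonical (a ⇨ b) = toCanonical a ⇨ toCanonical b := by
  refine le_antisymm ?_ fun w hw => ?_
  · rw [le_himp_iff, ← toCanonical_inf]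
    exact fun p hp => p.mem_of_le himp_inf_le hp
  · by_contra hab
    obtain ⟨u, hu, hbu⟩ := PrimeFilter.exists_separating (F := {c | ∃ d ∈ w, c = d ⊓ a}) (I := {b})
      ⟨_, ⊤, w.mem_top, rfl⟩ ⟨b, rfl⟩
      (by
        rintro _ ⟨c, hc, rfl⟩ _ ⟨d, hd, rfl⟩
        exact ⟨c ⊓ d, w.mem_inf_iff.2 ⟨hc, hd⟩, inf_inf_distrib_right .. |>.symm⟩)
      (by rintro _ rfl _ rfl; simp)
      (by
        rintro _ ⟨c, hc, rfl⟩ _ rfl h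
        exact hab (w.mem_of_le (le_himp_iff.2 h) hc))
    have huw : u ≤ w := fun c hc => u.mem_of_le inf_le_left (hu _ ⟨c, hc, rfl⟩)
    have hau : a ∈ u := u.mem_of_le inf_le_right (hu _ ⟨⊤, w.mem_top, rfl⟩)
    refine hbu b rfl ?_
    have : u ∈ (toCanonical a ⇨ toCanonical b) ⊓ toCanonical a := ⟨LowerSet.lower _ huw hw, hau⟩
    exact (himp_inf_le (a := toCanonical a) (b := toCanonical b)) this

/-- Joins are unions, so if a principal lower set is a join, its generator lies in some member,
which is then the whole of it. Every lower set is the union of the principal ones it contains. -/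
theorem isPerfectLattice_lowerSet (X : Type u) [Preorder X] : IsPerfectLattice (LowerSet X) := by
  intro a
  refine ⟨{s | ∃ x ∈ a, s = LowerSet.Iic x}, ?_, ?_⟩
  · rintro _ ⟨x, -, rfl⟩ S hS
    have hx : x ∈ sSup S := hS ▸ LowerSet.mem_Iic_iff.2 le_rfl
    obtain ⟨s, hs, hxs⟩ := LowerSet.mem_sSup_iff.1 hx
    have : LowerSet.Iic x = s :=
      le_antisymm (fun y hy => s.lower hy hxs) (hS ▸ le_sSup hs)
    exact this ▸ hs
  · ext x
    refine ⟨fun hx => LowerSet.mem_sSup_iff.2 ⟨_, ⟨x, hx, rfl⟩, le_rfl⟩, fun hx => ?_⟩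
    obtain ⟨_, ⟨y, hy, rfl⟩, hxy⟩ := LowerSet.mem_sSup_iff.1 hx
    exact a.lower hxy hy

/-! ### Operations on lower sets of prime filters -/

namespace HetAlgebra

variable {𝔸 Q : Type u} [HeytingAlgebra 𝔸] [DistribLattice Q] [BoundedOrder Q]
  (F : HetAlgebra 𝔸 Q)

/-- The extension of `·` to the canonical extension. -/
def canonicalMul (q r : LowerSet (PrimeFilter Q)) : LowerSet (PrimeFilter Q) where
  carrier := {j | ∃ k ∈ q, ∃ l ∈ r, ∀ α ∈ k, ∀ β ∈ l, F.mul α β ∈ j}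
  lower' := fun _ _ h ⟨k, hk, l, hl, H⟩ => ⟨k, hk, l, hl, fun α hα β hβ => h _ (H α hα β hβ)⟩

/-- The extension of `▷` to the canonical extension. -/
def canonicalUse (q : LowerSet (PrimeFilter Q)) (a : LowerSet (PrimeFilter 𝔸)) :
    LowerSet (PrimeFilter 𝔸) where
  -- The condition on `I` says that the open set `⋃ c ∈ I, toCanonical c` contains `a`. The value is
  -- the meet, over points `j` of `q` and such open sets, of the joins of all `α ▷ c` with `α ∈ j`
  -- and `c ∈ I`: the π-extension of a map antitone in the first and monotone in the second
  -- argument.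
  carrier := {w | ∀ j ∈ q, ∀ I : Order.Ideal 𝔸, (∀ u ∈ a, ∃ c ∈ I, c ∈ u) →
    ∃ α ∈ j, ∃ c ∈ I, F.use α c ∈ w}
  lower' := fun _ _ h H j hj I hI =>
    let ⟨α, hα, c, hc, hw⟩ := H j hj I hI
    ⟨α, hα, c, hc, h _ hw⟩

/-- The extension of `◇` to the canonical extension. -/
def canonicalDia (a : LowerSet (PrimeFilter 𝔸)) : LowerSet (PrimeFilter 𝔸) where
  carrier := {w | ∃ u ∈ a, ∀ c ∈ u, F.dia c ∈ w}
  lower' := fun _ _ h ⟨u, hu, H⟩ => ⟨u, hu, fun c hc => h _ (H c hc)⟩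

/-- The extension of `◇ᵣ` to the canonical extension. -/
def canonicalHave (q : LowerSet (PrimeFilter Q)) : LowerSet (PrimeFilter 𝔸) where
  carrier := {w | ∃ j ∈ q, ∀ α ∈ j, F.have_ α ∈ w}
  lower' := fun _ _ h ⟨j, hj, H⟩ => ⟨j, hj, fun α hα => h _ (H α hα)⟩

/-- The extension of `▷ᵣ` to the canonical extension. -/
def canonicalGet (q r : LowerSet (PrimeFilter Q)) : LowerSet (PrimeFilter 𝔸) where
  -- Here the upper approximants of `r` are given by the prime ideals `pᶜ`: the open set `{u | ¬ u ⊆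
  -- p}` contains `r` exactly when `p ∉ r`.
  carrier := {w | ∀ j ∈ q, ∀ p, p ∉ r → ∃ α ∈ j, ∃ β, β ∉ p ∧ F.get α β ∈ w}
  lower' := fun _ _ h H j hj p hp =>
    let ⟨α, hα, β, hβ, hw⟩ := H j hj p hp
    ⟨α, hα, β, hβ, h _ hw⟩

/-! ### Existence of witnesses -/

/-- If `k · l ⊆ j` for filter bases `k`, `l` and a prime filter `j`, then `k` can be enlarged to a
prime filter. -/
theorem exists_left_factor {k l : Set Q} {j : PrimeFilter Q} (hk : k.Nonempty) (hl : l.Nonempty)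
    (k_inf : ∀ α ∈ k, ∀ β ∈ k, α ⊓ β ∈ k) (l_inf : ∀ α ∈ l, ∀ β ∈ l, α ⊓ β ∈ l)
    (H : ∀ α ∈ k, ∀ β ∈ l, F.mul α β ∈ j) :
    ∃ m : PrimeFilter Q, (∀ α ∈ k, α ∈ m) ∧ ∀ α ∈ m, ∀ β ∈ l, F.mul α β ∈ j := by
  -- The elements that fail against some `β ∈ l` form an ideal: two failures are witnessed jointly
  -- by `β ⊓ β'`, and `j` is prime.
  obtain ⟨m, hm, hm'⟩ := PrimeFilter.exists_separating (F := k)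
    (I := {α | ∃ β ∈ l, F.mul α β ∉ j}) hk
    (let ⟨β, hβ⟩ := hl; ⟨⊥, β, hβ, by rw [F.bot_mul]; exact j.notMem_bot⟩) k_inf
    (by
      rintro α ⟨β, hβ, hα⟩ α' ⟨β', hβ', hα'⟩
      refine ⟨β ⊓ β', l_inf _ hβ _ hβ', ?_⟩
      rw [F.sup_mul, j.mem_sup_iff, not_or]
      exact ⟨fun h => hα (j.mem_of_le (F.MF' _ _ _ inf_le_left) h),
        fun h => hα' (j.mem_of_le (F.MF' _ _ _ inf_le_right) h)⟩)
    (by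
      rintro α hα α' ⟨β, hβ, h⟩ hle
      exact h (j.mem_of_le (F.MF _ _ _ hle) (H α hα β hβ)))
  exact ⟨m, hm, fun α hα β hβ => by_contra fun h => hm' α ⟨β, hβ, h⟩ hα⟩

/-- If `k · l ⊆ j` for filter bases `k`, `l` and a prime filter `j`, then `l` can be enlarged to a
prime filter. -/
theorem exists_right_factor {k l : Set Q} {j : PrimeFilter Q} (hk : k.Nonempty) (hl : l.Nonempty)
    (k_inf : ∀ α ∈ k, ∀ β ∈ k, α ⊓ β ∈ k) (l_inf : ∀ α ∈ l, ∀ β ∈ l, α ⊓ β ∈ l)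
    (H : ∀ α ∈ k, ∀ β ∈ l, F.mul α β ∈ j) :
    ∃ m : PrimeFilter Q, (∀ β ∈ l, β ∈ m) ∧ ∀ α ∈ k, ∀ β ∈ m, F.mul α β ∈ j := by
  obtain ⟨m, hm, hm'⟩ := PrimeFilter.exists_separating (F := l)
    (I := {β | ∃ α ∈ k, F.mul α β ∉ j}) hl
    (let ⟨α, hα⟩ := hk; ⟨⊥, α, hα, by rw [F.mul_bot]; exact j.notMem_bot⟩) l_inf
    (by
      rintro β ⟨α, hα, hβ⟩ β' ⟨α', hα', hβ'⟩
      refine ⟨α ⊓ α', k_inf _ hα _ hα', ?_⟩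
      rw [F.mul_sup, j.mem_sup_iff, not_or]
      exact ⟨fun h => hβ (j.mem_of_le (F.MF _ _ _ inf_le_left) h),
        fun h => hβ' (j.mem_of_le (F.MF _ _ _ inf_le_right) h)⟩)
    (by
      rintro β hβ β' ⟨α, hα, h⟩ hle
      exact h (j.mem_of_le (F.MF' _ _ _ hle) (H α hα β hβ)))
  exact ⟨m, hm, fun α hα β hβ => by_contra fun h => hm' β ⟨α, hα, h⟩ hβ⟩

/-- The elements `c` with `◇ c` outside a prime filter form an ideal. -/
def diaIdeal (w : PrimeFilter 𝔸) : Order.Ideal 𝔸 :=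
  Order.IsIdeal.toIdeal (I := {c | F.dia c ∉ w})
    ⟨fun _ _ h ha hb => ha (w.mem_of_le (F.MD _ _ h) hb),
      ⟨⊥, fun h => w.notMem_bot (F.D2 ▸ h)⟩,
      fun a ha b hb => ⟨a ⊔ b, fun h => by
        rw [F.D1, w.mem_sup_iff] at h
        exact h.elim ha hb, le_sup_left, le_sup_right⟩⟩

/-- The elements below some `β ▷ c` with `β` in a prime filter and `c` in an ideal form an
ideal. -/
def useIdeal (l : PrimeFilter Q) (I : Order.Ideal 𝔸) : Order.Ideal 𝔸 :=
  Order.IsIdeal.toIdeal (I := {d | ∃ β ∈ l, ∃ c ∈ I, d ≤ F.use β c})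
    ⟨fun _ _ h ⟨β, hβ, c, hc, hd⟩ => ⟨β, hβ, c, hc, h.trans hd⟩,
      ⟨⊥, ⊤, l.mem_top, ⊥, I.bot_mem, bot_le⟩,
      fun d ⟨β, hβ, c, hc, hd⟩ d' ⟨β', hβ', c', hc', hd'⟩ =>
        ⟨d ⊔ d', ⟨β ⊓ β', l.inf_mem hβ hβ', c ⊔ c', Order.Ideal.sup_mem hc hc',
          sup_le
            (hd.trans ((F.AB _ _ _ inf_le_left).trans (F.MB _ _ _ le_sup_left)))
            (hd'.trans ((F.AB _ _ _ inf_le_right).trans (F.MB _ _ _ le_sup_right)))⟩,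
          le_sup_left, le_sup_right⟩⟩

/-! ### The embedding preserves the operations -/

theorem toCanonical_mul (α β : Q) :
    toCanonical (F.mul α β) = F.canonicalMul (toCanonical α) (toCanonical β) := by
  ext j
  refine ⟨fun h => ?_, fun ⟨k, hk, l, hl, H⟩ => H _ hk _ hl⟩
  -- The factors are enlarged one at a time: first `{α}` to a prime filter `k`, then `{β}` against
  -- all of `k`.
  obtain ⟨k, hk, H⟩ := F.exists_left_factor (k := {α}) (l := {β}) (j := j) ⟨α, rfl⟩ ⟨β, rfl⟩
    (by rintro _ rfl _ rfl; simp) (by rintro _ rfl _ rfl; simp) (by rintro _ rfl _ rfl; exact h)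
  obtain ⟨l, hl, H⟩ := F.exists_right_factor (k := k.carrier) (l := {β}) (j := j) ⟨⊤, k.mem_top⟩
    ⟨β, rfl⟩ (fun _ ha _ hb => k.inf_mem ha hb) (by rintro _ rfl _ rfl; simp) H
  exact ⟨k, hk α rfl, l, hl β rfl, H⟩

theorem toCanonical_dia (a : 𝔸) : toCanonical (F.dia a) = F.canonicalDia (toCanonical a) := by
  ext w
  refine ⟨fun h => ?_, fun ⟨u, hu, H⟩ => H _ hu⟩
  obtain ⟨u, hu, H⟩ := PrimeFilter.exists_mem_of_notMem_ideal (a := a)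
    (I := (F.diaIdeal w : Set 𝔸)) (F.diaIdeal w).bot_mem
    (fun _ ha _ hb => Order.Ideal.sup_mem ha hb)
    (fun _ _ h hb => (F.diaIdeal w).lower h hb) (fun h' => h' h)
  exact ⟨u, hu, fun c hc => by_contra fun h' => H c h' hc⟩

theorem toCanonical_have (α : Q) : toCanonical (F.have_ α) = F.canonicalHave (toCanonical α) := by
  ext w
  refine ⟨fun h => ?_, fun ⟨u, hu, H⟩ => H _ hu⟩
  obtain ⟨u, hu, H⟩ := PrimeFilter.exists_mem_of_notMem_ideal (a := α)
    (I := {β | F.have_ β ∉ w}) (by rw [Set.mem_ofPred_eq, F.D4]; exact w.notMem_bot)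
    (fun a ha b hb h' => by
      rw [F.D3, w.mem_sup_iff] at h'
      exact h'.elim ha hb)
    (fun _ _ h ha hb => ha (w.mem_of_le (F.MD' _ _ h) hb)) (fun h' => h' h)
  exact ⟨u, hu, fun c hc => by_contra fun h' => H c h' hc⟩

/-- An ideal covering `toCanonical a` must contain `a`, by separation; this gives one inclusion. For
the other, if `α ▷ a ∉ w` then `{β | β ▷ a ∈ w}` is an ideal omitting `α`; a prime filter through
`α` avoiding it, paired with the principal ideal of `a`, violates the condition at `w`. -/
theorem toCanonical_use (α : Q) (a : 𝔸) :
    toCanonical (F.use α a) = F.canonicalUse (toCanonical α) (toCanonical a) := by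
  ext w
  refine ⟨fun h j hj I hI => ⟨α, hj, a, ?_, h⟩, fun H => by_contra fun h => ?_⟩
  · by_contra ha
    obtain ⟨u, hu, hIu⟩ := PrimeFilter.exists_mem_of_notMem_ideal (a := a)
      (I := (I : Set 𝔸)) I.bot_mem (fun _ ha _ hb => Order.Ideal.sup_mem ha hb)
      (fun _ _ h hb => I.lower h hb) ha
    obtain ⟨c, hc, hcu⟩ := hI u hu
    exact hIu c hc hcu
  · obtain ⟨j, hj, hI⟩ := PrimeFilter.exists_mem_of_notMem_ideal (a := α)
      (I := {β | F.use β a ∈ w}) (by rw [Set.mem_ofPred_eq, F.B2]; exact w.mem_top)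
      (fun _ ha _ hb => by
        rw [Set.mem_ofPred_eq, F.B1]
        exact w.inf_mem ha hb)
      (fun _ _ h hb => w.mem_of_le (F.AB _ _ _ h) hb) h
    obtain ⟨β, hβ, c, hc, hw⟩ := H j hj (Order.Ideal.principal a) fun u hu => ⟨a, le_rfl, hu⟩
    exact hI β (w.mem_of_le (F.MB _ _ _ hc) hw) hβ

/-- The nontrivial inclusion takes two separations. If `α ▷ᵣ β ∉ w`, a prime `p` omitting `β`
contains the filter `{γ | α ▷ᵣ γ ∈ w}`. Then the ideal of all `δ` with `δ ▷ᵣ γ ∈ w` for some `γ ∉ p`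
omits `α`, which yields `j`. -/
theorem toCanonical_get (α β : Q) :
    toCanonical (F.get α β) = F.canonicalGet (toCanonical α) (toCanonical β) := by
  ext w
  refine ⟨fun h j hj p hp => ⟨α, hj, β, hp, h⟩, fun H => by_contra fun h => ?_⟩
  obtain ⟨p, hp, hβ⟩ := PrimeFilter.exists_notMem_of_notMem_filter (a := β)
    (F := {γ | F.get α γ ∈ w}) (by rw [Set.mem_ofPred_eq, F.B7]; exact w.mem_top)
    (fun _ ha _ hb => by
      rw [Set.mem_ofPred_eq, F.B6]
      exact w.inf_mem ha hb)
    (fun _ _ h hb => w.mem_of_le (F.MB' _ _ _ h) hb) h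
  obtain ⟨j, hj, hI⟩ := PrimeFilter.exists_mem_of_notMem_ideal (a := α)
    (I := {δ | ∃ γ, γ ∉ p ∧ F.get δ γ ∈ w})
    ⟨⊥, p.notMem_bot, by rw [F.B5]; exact w.mem_top⟩
    (by
      rintro δ ⟨γ, hγ, hw⟩ δ' ⟨γ', hγ', hw'⟩
      refine ⟨γ ⊔ γ', fun h => (p.mem_sup_iff.1 h).elim hγ hγ', ?_⟩
      rw [F.B4]
      exact w.inf_mem (w.mem_of_le (F.MB' _ _ _ le_sup_left) hw)
        (w.mem_of_le (F.MB' _ _ _ le_sup_right) hw'))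
    (fun _ _ h ⟨γ, hγ, hw⟩ => ⟨γ, hγ, w.mem_of_le (F.AB' _ _ _ h) hw⟩)
    (fun ⟨γ, hγ, hw⟩ => hγ (hp γ hw))
  obtain ⟨δ, hδ, γ, hγ, hw⟩ := H j hj p hβ
  exact hI δ ⟨γ, hγ, hw⟩ hδ

/-! ### The laws of the canonical extension -/

theorem canonicalMul_mono {q q' r r' : LowerSet (PrimeFilter Q)} (h : q ≤ q') (h' : r ≤ r') :
    F.canonicalMul q r ≤ F.canonicalMul q' r' :=
  fun _ ⟨k, hk, l, hl, H⟩ => ⟨k, h hk, l, h' hl, H⟩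

theorem canonicalUse_mono {q q' : LowerSet (PrimeFilter Q)} {a a' : LowerSet (PrimeFilter 𝔸)}
    (h : q ≤ q') (h' : a ≤ a') : F.canonicalUse q' a ≤ F.canonicalUse q a' :=
  fun _ H j hj I hI => H j (h hj) I fun u hu => hI u (h' hu)

theorem canonicalDia_mono {a a' : LowerSet (PrimeFilter 𝔸)} (h : a ≤ a') :
    F.canonicalDia a ≤ F.canonicalDia a' :=
  fun _ ⟨u, hu, H⟩ => ⟨u, h hu, H⟩

theorem canonicalHave_mono {q q' : LowerSet (PrimeFilter Q)} (h : q ≤ q') :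
    F.canonicalHave q ≤ F.canonicalHave q' :=
  fun _ ⟨u, hu, H⟩ => ⟨u, h hu, H⟩

theorem canonicalGet_mono {q q' r r' : LowerSet (PrimeFilter Q)} (h : q ≤ q') (h' : r ≤ r') :
    F.canonicalGet q' r ≤ F.canonicalGet q r' :=
  fun _ H j hj p hp => H j (h hj) p fun hr => hp (h' hr)

/-- A point of a join lies in one of the joinands. Hence an operation quantifying existentially over
the points of an argument preserves joins in it, and one quantifying universally turns them into
meets; this covers all the `sSup` laws below. -/
theorem canonicalMul_sSup (q : LowerSet (PrimeFilter Q)) (S : Set (LowerSet (PrimeFilter Q))) :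
    F.canonicalMul q (sSup S) = ⨆ r ∈ S, F.canonicalMul q r := by
  refine le_antisymm ?_ (iSup₂_le fun r hr => F.canonicalMul_mono le_rfl (le_sSup hr))
  rintro j ⟨k, hk, l, hl, H⟩
  obtain ⟨r, hr, hl⟩ := LowerSet.mem_sSup_iff.1 hl
  exact LowerSet.mem_iSup₂_iff.2 ⟨r, hr, k, hk, l, hl, H⟩

theorem canonicalMul_sSup_left (S : Set (LowerSet (PrimeFilter Q)))
    (q : LowerSet (PrimeFilter Q)) :
    F.canonicalMul (sSup S) q = ⨆ r ∈ S, F.canonicalMul r q := by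
  refine le_antisymm ?_ (iSup₂_le fun r hr => F.canonicalMul_mono (le_sSup hr) le_rfl)
  rintro j ⟨k, hk, l, hl, H⟩
  obtain ⟨r, hr, hk⟩ := LowerSet.mem_sSup_iff.1 hk
  exact LowerSet.mem_iSup₂_iff.2 ⟨r, hr, k, hk, l, hl, H⟩

theorem canonicalDia_sSup (S : Set (LowerSet (PrimeFilter 𝔸))) :
    F.canonicalDia (sSup S) = ⨆ a ∈ S, F.canonicalDia a := by
  refine le_antisymm ?_ (iSup₂_le fun r hr => F.canonicalDia_mono (le_sSup hr))
  rintro w ⟨u, hu, H⟩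
  obtain ⟨a, ha, hu⟩ := LowerSet.mem_sSup_iff.1 hu
  exact LowerSet.mem_iSup₂_iff.2 ⟨a, ha, u, hu, H⟩

theorem canonicalHave_sSup (S : Set (LowerSet (PrimeFilter Q))) :
    F.canonicalHave (sSup S) = ⨆ q ∈ S, F.canonicalHave q := by
  refine le_antisymm ?_ (iSup₂_le fun r hr => F.canonicalHave_mono (le_sSup hr))
  rintro w ⟨u, hu, H⟩
  obtain ⟨a, ha, hu⟩ := LowerSet.mem_sSup_iff.1 hu
  exact LowerSet.mem_iSup₂_iff.2 ⟨a, ha, u, hu, H⟩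

theorem canonicalUse_sSup (S : Set (LowerSet (PrimeFilter Q))) (a : LowerSet (PrimeFilter 𝔸)) :
    F.canonicalUse (sSup S) a = ⨅ q ∈ S, F.canonicalUse q a := by
  refine le_antisymm (le_iInf₂ fun q hq => F.canonicalUse_mono (le_sSup hq) le_rfl) ?_
  intro w hw j hj
  obtain ⟨q, hq, hj⟩ := LowerSet.mem_sSup_iff.1 hj
  exact LowerSet.mem_iInf₂_iff.1 hw q hq j hj

theorem canonicalGet_sSup (S : Set (LowerSet (PrimeFilter Q))) (r : LowerSet (PrimeFilter Q)) :
    F.canonicalGet (sSup S) r = ⨅ q ∈ S, F.canonicalGet q r := by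
  refine le_antisymm (le_iInf₂ fun q hq => F.canonicalGet_mono (le_sSup hq) le_rfl) ?_
  intro w hw j hj
  obtain ⟨q, hq, hj⟩ := LowerSet.mem_sSup_iff.1 hj
  exact LowerSet.mem_iInf₂_iff.1 hw q hq j hj

/-- The second argument enters only through the points outside it, and a point outside an
intersection is outside some member. -/
theorem canonicalGet_sInf (q : LowerSet (PrimeFilter Q)) (S : Set (LowerSet (PrimeFilter Q))) :
    F.canonicalGet q (sInf S) = ⨅ r ∈ S, F.canonicalGet q r := by
  refine le_antisymm (le_iInf₂ fun r hr => F.canonicalGet_mono le_rfl (sInf_le hr)) ?_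
  intro w hw j hj p hp
  rw [LowerSet.mem_sInf_iff] at hp
  push Not at hp
  obtain ⟨r, hr, hp⟩ := hp
  exact LowerSet.mem_iInf₂_iff.1 hw r hr j hj p hp

/-- Both sides say that `k · l · n ⊆ j` for suitable prime filters. To rebracket, the filter
generated by the products of two of them is enlarged to a prime filter whose product with the third
still lies in `j`. -/
theorem canonicalMul_assoc (q r s : LowerSet (PrimeFilter Q)) :
    F.canonicalMul (F.canonicalMul q r) s = F.canonicalMul q (F.canonicalMul r s) := by
  ext j
  constructor
  · rintro ⟨m, ⟨k, hk, l, hl, H⟩, n, hn, H'⟩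
    obtain ⟨t, ht, hkt⟩ := F.exists_right_factor (k := k.carrier)
      (l := {γ | ∃ β ∈ l, ∃ ν ∈ n, F.mul β ν ≤ γ}) (j := j) ⟨⊤, k.mem_top⟩
      ⟨_, ⊤, l.mem_top, ⊤, n.mem_top, le_rfl⟩ (fun _ ha _ hb => k.inf_mem ha hb)
      (by
        rintro γ ⟨β, hβ, ν, hν, h⟩ γ' ⟨β', hβ', ν', hν', h'⟩
        exact ⟨β ⊓ β', l.inf_mem hβ hβ', ν ⊓ ν', n.inf_mem hν hν',
          le_inf (((F.MF _ _ _ inf_le_left).trans (F.MF' _ _ _ inf_le_left)).trans h)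
            (((F.MF _ _ _ inf_le_right).trans (F.MF' _ _ _ inf_le_right)).trans h')⟩)
      (by
        rintro α hα γ ⟨β, hβ, ν, hν, h⟩
        refine j.mem_of_le (F.MF' _ _ _ h) ?_
        rw [← F.mul_assoc]
        exact H' _ (H α hα β hβ) ν hν)
    exact ⟨k, hk, t, ⟨l, hl, n, hn, fun β hβ ν hν => ht _ ⟨β, hβ, ν, hν, le_rfl⟩⟩, hkt⟩
  · rintro ⟨k, hk, m, ⟨l, hl, n, hn, H⟩, H'⟩
    obtain ⟨t, ht, htn⟩ := F.exists_left_factor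
      (k := {γ | ∃ α ∈ k, ∃ β ∈ l, F.mul α β ≤ γ}) (l := n.carrier) (j := j)
      ⟨_, ⊤, k.mem_top, ⊤, l.mem_top, le_rfl⟩ ⟨⊤, n.mem_top⟩
      (by
        rintro γ ⟨β, hβ, ν, hν, h⟩ γ' ⟨β', hβ', ν', hν', h'⟩
        exact ⟨β ⊓ β', k.inf_mem hβ hβ', ν ⊓ ν', l.inf_mem hν hν',
          le_inf (((F.MF _ _ _ inf_le_left).trans (F.MF' _ _ _ inf_le_left)).trans h)
            (((F.MF _ _ _ inf_le_right).trans (F.MF' _ _ _ inf_le_right)).trans h')⟩)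
      (fun _ ha _ hb => n.inf_mem ha hb)
      (by
        rintro γ ⟨α, hα, β, hβ, h⟩ ν hν
        refine j.mem_of_le (F.MF _ _ _ h) ?_
        rw [F.mul_assoc]
        exact H' α hα _ (H β hβ ν hν))
    exact ⟨t, ⟨k, hk, l, hl, fun α hα β hβ => ht _ ⟨α, hα, β, hβ, le_rfl⟩⟩, n, hn, htn⟩

theorem top_canonicalMul (q : LowerSet (PrimeFilter Q)) : F.canonicalMul ⊤ q = q := by
  ext j
  constructor
  · rintro ⟨k, -, l, hl, H⟩
    exact q.lower (fun β hβ => F.top_mul β ▸ H ⊤ k.mem_top β hβ) hl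
  · intro hj
    obtain ⟨k, -, H⟩ := F.exists_left_factor (k := {⊤}) (l := j.carrier) (j := j)
      ⟨⊤, rfl⟩ ⟨⊤, j.mem_top⟩ (by rintro _ rfl _ rfl; simp) (fun _ ha _ hb => j.inf_mem ha hb)
      (by rintro _ rfl β hβ; rw [F.top_mul]; exact hβ)
    exact ⟨k, trivial, j, hj, H⟩

theorem canonicalMul_top (q : LowerSet (PrimeFilter Q)) : F.canonicalMul q ⊤ = q := by
  ext j
  constructor
  · rintro ⟨k, hk, l, -, H⟩
    exact q.lower (fun β hβ => F.mul_top β ▸ H β hβ ⊤ l.mem_top) hk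
  · intro hj
    obtain ⟨l, -, H⟩ := F.exists_right_factor (k := j.carrier) (l := {⊤}) (j := j)
      ⟨⊤, j.mem_top⟩ ⟨⊤, rfl⟩ (fun _ ha _ hb => j.inf_mem ha hb) (by rintro _ rfl _ rfl; simp)
      (by rintro β hβ _ rfl; rw [F.mul_top]; exact hβ)
    exact ⟨j, hj, l, trivial, H⟩

/-- If `I` covers `a` and `l ∈ r`, then `useIdeal l I` covers `r ▷ a`. The outer condition for this
ideal gives some `α ▷ (β ▷ d) ∈ w`, to which `B3` applies. -/
theorem canonicalUse_canonicalUse_le (q r : LowerSet (PrimeFilter Q))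
    (a : LowerSet (PrimeFilter 𝔸)) :
    F.canonicalUse q (F.canonicalUse r a) ≤ F.canonicalUse (F.canonicalMul q r) a := by
  rintro w hw j ⟨k, hk, l, hl, H⟩ I hI
  obtain ⟨α, hα, c, ⟨β, hβ, d, hd, hc⟩, h⟩ := hw k hk (F.useIdeal l I) fun u hu => by
    obtain ⟨β, hβ, d, hd, h⟩ := hu l hl I hI
    exact ⟨_, ⟨β, hβ, d, hd, le_rfl⟩, h⟩
  exact ⟨_, H α hα β hβ, d, hd, w.mem_of_le ((F.MB _ _ _ hc).trans (F.B3 _ _ _)) h⟩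

/-- If no point of `a` witnesses `◇` at `w`, then the ideal `{c | ◇ c ∉ w}` covers `a`. The
condition for `▷` then yields `α ▷ c ∈ w` with `c` in it, contradicting `BD1`. -/
theorem canonicalHave_inf_canonicalUse_le (q : LowerSet (PrimeFilter Q))
    (a : LowerSet (PrimeFilter 𝔸)) :
    F.canonicalHave q ⊓ F.canonicalUse q a ≤ F.canonicalDia a := by
  rintro w ⟨⟨j, hj, H⟩, hw⟩
  by_contra hdia
  obtain ⟨α, hα, c, hc, h⟩ := hw j hj (F.diaIdeal w) fun u hu => by
    by_contra h
    exact hdia ⟨u, hu, fun c hc => by_contra fun hc' => h ⟨c, hc', hc⟩⟩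
  exact hc (w.mem_of_le (F.BD1 α c) (w.inf_mem (H α hα) h))

/-- If the condition for `▷` fails at `j` and `I`, then by `BD2` the filter of all `β` with `α ▷ᵣ β
∈ w` for some `α ∈ j` misses the ideal `{β | ◇ᵣ β ∈ I}`; let a prime `p` separate them. If `p ∈ r`,
the image `◇ᵣ p` would extend to a prime filter avoiding `I`, although `I` covers `◇ᵣ r`. So `p ∉
r`, and the condition for `▷ᵣ` gives an element of that filter outside `p`. -/
theorem canonicalGet_le_canonicalUse (q r : LowerSet (PrimeFilter Q)) :
    F.canonicalGet q r ≤ F.canonicalUse q (F.canonicalHave r) := by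
  intro w hw j hj I hI
  by_contra hcon
  obtain ⟨p, hp, hp'⟩ := PrimeFilter.exists_separating (F := {β | ∃ α ∈ j, F.get α β ∈ w})
    (I := {β | F.have_ β ∈ I})
    ⟨⊤, ⊤, j.mem_top, by rw [F.B7]; exact w.mem_top⟩
    ⟨⊥, by rw [Set.mem_ofPred_eq, F.D4]; exact I.bot_mem⟩
    (by
      rintro β ⟨α, hα, h⟩ β' ⟨α', hα', h'⟩
      refine ⟨α ⊓ α', j.inf_mem hα hα', ?_⟩
      rw [F.B6]
      exact w.inf_mem (w.mem_of_le (F.AB' _ _ _ inf_le_left) h)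
        (w.mem_of_le (F.AB' _ _ _ inf_le_right) h'))
    (fun a ha b hb => by
      rw [Set.mem_ofPred_eq, F.D3]
      exact Order.Ideal.sup_mem ha hb)
    (by
      rintro β ⟨α, hα, h⟩ γ hγ hle
      exact hcon ⟨α, hα, _, hγ, w.mem_of_le ((F.MB' _ _ _ hle).trans (F.BD2 α γ)) h⟩)
  have hpr : p ∉ r := by
    intro hpr
    obtain ⟨u, hu, hu'⟩ := PrimeFilter.exists_separating (F := {c | ∃ β ∈ p, F.have_ β ≤ c})
      (I := (I : Set 𝔸)) ⟨_, ⊤, p.mem_top, le_rfl⟩ ⟨⊥, I.bot_mem⟩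
      (by
        rintro c ⟨β, hβ, h⟩ c' ⟨β', hβ', h'⟩
        exact ⟨β ⊓ β', p.inf_mem hβ hβ', le_inf ((F.MD' _ _ inf_le_left).trans h)
          ((F.MD' _ _ inf_le_right).trans h')⟩)
      (fun _ ha _ hb => Order.Ideal.sup_mem ha hb)
      (by
        rintro c ⟨β, hβ, h⟩ d hd hle
        exact hp' β (I.lower (h.trans hle) hd) hβ)
    obtain ⟨c, hc, hcu⟩ := hI u ⟨p, hpr, fun β hβ => hu _ ⟨β, hβ, le_rfl⟩⟩
    exact hu' c hc hcu
  obtain ⟨α, hα, β, hβ, h⟩ := hw j hj p hpr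
  exact hβ (hp β ⟨α, hα, h⟩)

/-- The canonical extension of a heterogeneous LRC-algebra. -/
def canonicalExtension : HetAlgebra (LowerSet (PrimeFilter 𝔸)) (LowerSet (PrimeFilter Q)) where
  mul := F.canonicalMul
  use := F.canonicalUse
  dia := F.canonicalDia
  have_ := F.canonicalHave
  get := F.canonicalGet
  mul_assoc := F.canonicalMul_assoc
  top_mul := F.top_canonicalMul
  mul_top := F.canonicalMul_top
  -- The finitary laws are the infinitary ones for a pair or for the empty family.
  mul_sup q r s := by rw [← sSup_pair, canonicalMul_sSup, iSup_pair]
  sup_mul q r s := by rw [← sSup_pair, canonicalMul_sSup_left, iSup_pair]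
  mul_bot q := by rw [← sSup_empty, canonicalMul_sSup]; simp
  bot_mul q := by rw [← sSup_empty, canonicalMul_sSup_left]; simp
  D1 a b := by rw [← sSup_pair, canonicalDia_sSup, iSup_pair]
  D2 := by rw [← sSup_empty, canonicalDia_sSup]; simp
  D3 q r := by rw [← sSup_pair, canonicalHave_sSup, iSup_pair]
  D4 := by rw [← sSup_empty, canonicalHave_sSup]; simp
  B1 q r a := by rw [← sSup_pair, canonicalUse_sSup, iInf_pair]
  B2 a := by rw [← sSup_empty, canonicalUse_sSup]; simp
  B3 := F.canonicalUse_canonicalUse_le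
  B4 q r s := by rw [← sSup_pair, canonicalGet_sSup, iInf_pair]
  B5 q := by rw [← sSup_empty, canonicalGet_sSup]; simp
  B6 q r s := by rw [← sInf_pair, canonicalGet_sInf, iInf_pair]
  B7 q := by rw [← sInf_empty, canonicalGet_sInf]; simp
  BD1 := F.canonicalHave_inf_canonicalUse_le
  BD2 := F.canonicalGet_le_canonicalUse
  MF _ _ _ h := F.canonicalMul_mono h le_rfl
  MF' _ _ _ h := F.canonicalMul_mono le_rfl h
  MB _ _ _ h := F.canonicalUse_mono le_rfl h
  MD _ _ h := F.canonicalDia_mono h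
  AB _ _ _ h := F.canonicalUse_mono h le_rfl
  MD' _ _ h := F.canonicalHave_mono h
  MB' _ _ _ h := F.canonicalGet_mono le_rfl h
  AB' _ _ _ h := F.canonicalGet_mono h le_rfl

theorem isPerfect_canonicalExtension : F.canonicalExtension.IsPerfect where
  perfect_fm := isPerfectLattice_lowerSet _
  perfect_res := isPerfectLattice_lowerSet _
  mul_sSup := F.canonicalMul_sSup
  sSup_mul := F.canonicalMul_sSup_left
  dia_sSup := F.canonicalDia_sSup
  have_sSup := F.canonicalHave_sSup
  use_sSup := F.canonicalUse_sSup
  get_sSup := F.canonicalGet_sSup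
  get_sInf := F.canonicalGet_sInf

/-! ### Evaluation commutes with the embedding -/

variable {P R : Type u} (v : P → 𝔸) (w : R → Q)

theorem evalRes_canonicalExtension (α : Res R) :
    F.canonicalExtension.evalRes (fun a => toCanonical (w a)) α =
      toCanonical (F.evalRes w α) := by
  induction α with
  | atom a => rfl
  | one => exact toCanonical_top.symm
  | zero => exact toCanonical_bot.symm
  | mul α β hα hβ => rw [evalRes, evalRes, hα, hβ, toCanonical_mul]; rfl
  | sup α β hα hβ => rw [evalRes, evalRes, hα, hβ, toCanonical_sup]
  | inf α β hα hβ => rw [evalRes, evalRes, hα, hβ, toCanonical_inf]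

theorem evalFm_canonicalExtension (A : Fm P R) :
    F.canonicalExtension.evalFm (fun p => toCanonical (v p)) (fun a => toCanonical (w a)) A =
      toCanonical (F.evalFm v w A) := by
  induction A with
  | atom p => rfl
  | top => exact toCanonical_top.symm
  | bot => exact toCanonical_bot.symm
  | or A B hA hB => rw [evalFm, evalFm, hA, hB, toCanonical_sup]
  | and A B hA hB => rw [evalFm, evalFm, hA, hB, toCanonical_inf]
  | imp A B hA hB => rw [evalFm, evalFm, hA, hB, toCanonical_himp]
  | use α A hA => rw [evalFm, evalFm, hA, evalRes_canonicalExtension, toCanonical_use]; rfl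
  | dia A hA => rw [evalFm, evalFm, hA, toCanonical_dia]; rfl
  | have_ α => rw [evalFm, evalFm, evalRes_canonicalExtension, toCanonical_have]; rfl
  | get α β =>
    rw [evalFm, evalFm, evalRes_canonicalExtension, evalRes_canonicalExtension, toCanonical_get]
    rfl

end HetAlgebra

/-! ### Soundness -/

theorem ResEntails.sound {R 𝔸 Q : Type u} [HeytingAlgebra 𝔸] [DistribLattice Q] [BoundedOrder Q]
    (F : HetAlgebra 𝔸 Q) (w : R → Q) {α β : Res R} (h : ResEntails α β) :
    F.evalRes w α ≤ F.evalRes w β := by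
  induction h with
  | refl α => exact le_rfl
  | trans _ _ h h' => exact h.trans h'
  | inf_left => exact inf_le_left
  | inf_right => exact inf_le_right
  | le_inf _ _ h h' => exact _root_.le_inf h h'
  | left_sup => exact le_sup_left
  | right_sup => exact le_sup_right
  | sup_le _ _ h h' => exact _root_.sup_le h h'
  | R1_inf_sup => exact inf_sup_left .. |>.le
  | R1_sup_inf => exact sup_inf_left .. |>.ge
  | R2_assoc => exact F.mul_assoc _ _ _ |>.le
  | R2_assoc' => exact F.mul_assoc _ _ _ |>.ge
  | R2_one_mul => exact F.top_mul _ |>.le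
  | R2_one_mul' => exact F.top_mul _ |>.ge
  | R2_mul_one => exact F.mul_top _ |>.le
  | R2_mul_one' => exact F.mul_top _ |>.ge
  | R3_one => exact le_top
  | R3_zero => exact bot_le
  | R4_left => exact F.mul_sup _ _ _ |>.le
  | R4_right => exact F.sup_mul _ _ _ |>.le
  | MF _ _ h => exact F.MF _ _ _ h
  | MF' _ _ h => exact F.MF' _ _ _ h

namespace HetAlgebra

variable {P R 𝔸 Q : Type u} [HeytingAlgebra 𝔸] [DistribLattice Q] [BoundedOrder Q]
  (F : HetAlgebra 𝔸 Q) (v : P → 𝔸) (w : R → Q)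

theorem evalRes_subst (τ : R → Res R) (α : Res R) :
    F.evalRes w (α.subst τ) = F.evalRes (fun a => F.evalRes w (τ a)) α := by
  induction α <;> simp_all [Res.subst, evalRes]

theorem evalFm_subst (σ : P → Fm P R) (τ : R → Res R) (A : Fm P R) :
    F.evalFm v w (A.subst σ τ) =
      F.evalFm (fun p => F.evalFm v w (σ p)) (fun a => F.evalRes w (τ a)) A := by
  induction A <;> simp_all [Fm.subst, evalFm, evalRes_subst]

theorem evalFm_iff_of_eq {A B : Fm P R} (h : F.evalFm v w A = F.evalFm v w B) :
    F.evalFm v w (A.iff B) = ⊤ := by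
  simp [Fm.iff, evalFm, h]

theorem le_evalFm_imp {A B : Fm P R} {c : 𝔸} (h : F.evalFm v w A ≤ F.evalFm v w B) :
    c ≤ F.evalFm v w (.imp A B) :=
  le_himp_iff.2 (inf_le_right.trans h)

theorem evalFm_imp_of_le {A B : Fm P R} (h : F.evalFm v w A ≤ F.evalFm v w B) :
    F.evalFm v w (.imp A B) = ⊤ :=
  himp_eq_top_iff.2 h

end HetAlgebra

theorem IsAxiom.sound {P R 𝔸 Q : Type u} [HeytingAlgebra 𝔸] [DistribLattice Q] [BoundedOrder Q]
    (F : HetAlgebra 𝔸 Q) (v : P → 𝔸) (w : R → Q) {A : Fm P R} (h : IsAxiom A) :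
    F.evalFm v w A = ⊤ := by
  cases h with
  | imp_K => exact F.evalFm_imp_of_le v w (le_himp_iff.2 inf_le_left)
  | imp_S A B C =>
    refine F.evalFm_imp_of_le v w (le_himp_iff.2 (le_himp_iff.2 ?_))
    simp only [HetAlgebra.evalFm]
    generalize F.evalFm v w A = a
    generalize F.evalFm v w B = b
    generalize F.evalFm v w C = c
    have h₁ : (a ⇨ b ⇨ c) ⊓ (a ⇨ b) ⊓ a ≤ b :=
      (inf_le_inf_right a inf_le_right).trans himp_inf_le
    have h₂ : (a ⇨ b ⇨ c) ⊓ (a ⇨ b) ⊓ a ≤ b ⇨ c :=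
      (inf_le_inf_right a inf_le_left).trans himp_inf_le
    exact (le_inf h₂ h₁).trans himp_inf_le
  | and_left => exact F.evalFm_imp_of_le v w inf_le_left
  | and_right => exact F.evalFm_imp_of_le v w inf_le_right
  | and_intro => exact F.evalFm_imp_of_le v w (le_himp_iff.2 le_rfl)
  | or_left => exact F.evalFm_imp_of_le v w le_sup_left
  | or_right => exact F.evalFm_imp_of_le v w le_sup_right
  | or_elim =>
    refine F.evalFm_imp_of_le v w (le_himp_iff.2 ?_)
    simp only [HetAlgebra.evalFm]
    exact sup_himp_distrib .. |>.ge
  | bot_elim => exact F.evalFm_imp_of_le v w bot_le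
  | top_intro => rfl
  | D1 => exact F.evalFm_iff_of_eq v w (F.D1 _ _)
  | D2 => exact F.evalFm_iff_of_eq v w F.D2
  | D3 => exact F.evalFm_iff_of_eq v w (F.D3 _ _)
  | D4 => exact F.evalFm_iff_of_eq v w F.D4
  | B1 => exact F.evalFm_iff_of_eq v w (F.B1 _ _ _)
  | B2 => exact F.B2 _
  | B3 => exact F.evalFm_imp_of_le v w (F.B3 _ _ _)
  | B4 => exact F.evalFm_iff_of_eq v w (F.B4 _ _ _)
  | B5 => exact F.B5 _
  | B6 => exact F.evalFm_iff_of_eq v w (F.B6 _ _ _)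
  | B7 => exact F.B7 _
  | BD1 => exact F.evalFm_imp_of_le v w (F.BD1 _ _)
  | BD2 => exact F.evalFm_imp_of_le v w (F.BD2 _ _)

/-- Soundness for all algebras on a Heyting algebra, with the meet over the assumptions replaced by
an arbitrary lower bound. -/
theorem Derives.sound {P R 𝔸 Q : Type u} [HeytingAlgebra 𝔸] [DistribLattice Q] [BoundedOrder Q]
    (F : HetAlgebra 𝔸 Q) {X : Set (Fm P R)} {A : Fm P R} (h : Derives X A) :
    ∀ (v : P → 𝔸) (w : R → Q) (c : 𝔸), (∀ B ∈ X, c ≤ F.evalFm v w B) → c ≤ F.evalFm v w A := by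
  -- The assignments stay universally quantified because `subst` changes them, and the lower bound
  -- because the premises of `MB` and `MD` are used with the value of `A` as bound.
  induction h with
  | hyp h => exact fun v w c hc => hc _ h
  | ax h => exact fun v w c _ => le_top.trans (h.sound F v w).ge
  | mp _ _ h h' =>
    exact fun v w c hc => (le_inf (h v w c hc) (h' v w c hc)).trans himp_inf_le
  | subst σ τ _ h =>
    intro v w c _
    rw [F.evalFm_subst]
    exact le_top.trans (h _ _ ⊤ (by simp))
  | MB α _ h =>
    exact fun v w c _ => F.le_evalFm_imp v w (F.MB _ _ _ (h v w _ (by simp)))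
  | MD _ h =>
    exact fun v w c _ => F.le_evalFm_imp v w (F.MD _ _ (h v w _ (by simp)))
  | AB A h =>
    exact fun v w c _ => F.le_evalFm_imp v w (F.AB _ _ _ (h.sound F w))
  | MD' h =>
    exact fun v w c _ => F.le_evalFm_imp v w (F.MD' _ _ (h.sound F w))
  | MB' γ h =>
    exact fun v w c _ => F.le_evalFm_imp v w (F.MB' _ _ _ (h.sound F w))
  | AB' γ h =>
    exact fun v w c _ => F.le_evalFm_imp v w (F.AB' _ _ _ (h.sound F w))

/-! ### The Lindenbaum algebra -/

namespace Derives

variable {P R : Type u} {X Y : Set (Fm P R)} {A B C : Fm P R}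

theorem mono (h : Derives X A) : ∀ {Y}, X ⊆ Y → Derives Y A := by
  induction h with
  | hyp h => exact fun hXY => hyp (hXY h)
  | ax h => exact fun _ => ax h
  | mp _ _ h h' => exact fun hXY => mp (h hXY) (h' hXY)
  | subst σ τ h _ => exact fun _ => subst σ τ h
  | MB α h _ => exact fun _ => MB α h
  | MD h _ => exact fun _ => MD h
  | AB A h => exact fun _ => AB A h
  | MD' h => exact fun _ => MD' h
  | MB' γ h => exact fun _ => MB' γ h
  | AB' γ h => exact fun _ => AB' γ h

theorem of_empty (h : Derives ∅ A) : Derives X A := h.mono (Set.empty_subset X)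

theorem const (h : Derives X B) : Derives X (.imp A B) := mp (ax (.imp_K B A)) h

theorem imp_self : Derives X (.imp A A) :=
  mp (mp (ax (.imp_S A (.imp A A) A)) (ax (.imp_K A (.imp A A)))) (ax (.imp_K A A))

/-- Apart from `hyp` and `mp`, every rule concludes a formula derivable from any set, so `imp_K`
suffices. The inclusion replaces `X = insert A Y` so that the index of the induction remains a
variable. -/
theorem deduction_aux (h : Derives X B) : ∀ {Y}, X ⊆ insert A Y → Derives Y (.imp A B) := by
  induction h with
  | hyp h =>
    intro Y hXY
    rcases hXY h with rfl | h
    · exact imp_self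
    · exact const (hyp h)
  | ax h => exact fun _ => const (ax h)
  | mp _ _ h h' => exact fun hXY => mp (mp (ax (.imp_S _ _ _)) (h hXY)) (h' hXY)
  | subst σ τ h _ => exact fun _ => const (subst σ τ h)
  | MB α h _ => exact fun _ => const (MB α h)
  | MD h _ => exact fun _ => const (MD h)
  | AB A h => exact fun _ => const (AB A h)
  | MD' h => exact fun _ => const (MD' h)
  | MB' γ h => exact fun _ => const (MB' γ h)
  | AB' γ h => exact fun _ => const (AB' γ h)

/-- The deduction theorem. -/
theorem imp_intro (h : Derives (insert A X) B) : Derives X (.imp A B) :=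
  h.deduction_aux subset_rfl

theorem imp_elim (h : Derives X (.imp A B)) : Derives (insert A X) B :=
  mp (h.mono (Set.subset_insert A X)) (hyp (Set.mem_insert A X))

/-- This turns the order of the Lindenbaum algebra into the premise format of `MB` and `MD`. -/
theorem singleton_iff : Derives {A} B ↔ Derives ∅ (.imp A B) :=
  ⟨fun h => h.deduction_aux (by simp), fun h => mp h.of_empty (hyp rfl)⟩

theorem and_intro (h : Derives X A) (h' : Derives X B) : Derives X (.and A B) :=
  mp (mp (ax (.and_intro A B)) h) h'

theorem and_left (h : Derives X (.and A B)) : Derives X A := mp (ax (.and_left A B)) h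

theorem and_right (h : Derives X (.and A B)) : Derives X B := mp (ax (.and_right A B)) h

theorem or_elim (h : Derives X (.imp A C)) (h' : Derives X (.imp B C)) :
    Derives X (.imp (.or A B) C) :=
  mp (mp (ax (.or_elim A B C)) h) h'

theorem imp_trans (h : Derives X (.imp A B)) (h' : Derives X (.imp B C)) :
    Derives X (.imp A C) :=
  mp (mp (ax (.imp_S A B C)) (const h')) h

theorem imp_and (h : Derives X (.imp A B)) (h' : Derives X (.imp A C)) :
    Derives X (.imp A (.and B C)) :=
  imp_intro (and_intro (imp_elim h) (imp_elim h'))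

theorem imp_imp_iff : Derives X (.imp A (.imp B C)) ↔ Derives X (.imp (.and A B) C) := by
  constructor
  · intro h
    exact mp (mp (ax (.imp_S _ _ _)) (imp_trans (ax (.and_left A B)) h)) (ax (.and_right A B))
  · intro h
    exact imp_trans (ax (.and_intro A B)) (mp (ax (.imp_S _ _ _)) (const h))

end Derives

/-- Interderivability of formulas. -/
instance Fm.setoid (P R : Type u) : Setoid (Fm P R) where
  r A B := Derives ∅ (.imp A B) ∧ Derives ∅ (.imp B A)
  iseqv := ⟨fun _ => ⟨.imp_self, .imp_self⟩, fun h => ⟨h.2, h.1⟩,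
    fun h h' => ⟨h.1.imp_trans h'.1, h'.2.imp_trans h.2⟩⟩

/-- Interderivability of resource terms. -/
instance Res.setoid (R : Type u) : Setoid (Res R) where
  r α β := ResEntails α β ∧ ResEntails β α
  iseqv := ⟨fun α => ⟨.refl α, .refl α⟩, fun h => ⟨h.2, h.1⟩,
    fun h h' => ⟨h.1.trans h'.1, h'.2.trans h.2⟩⟩

/-- The Lindenbaum algebra of formulas. -/
def LindenbaumFm (P R : Type u) : Type u := Quotient (Fm.setoid P R)

/-- The Lindenbaum algebra of resource terms. -/
def LindenbaumRes (R : Type u) : Type u := Quotient (Res.setoid R)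

/-- The class of a formula in the Lindenbaum algebra. -/
def Fm.cls {P R : Type u} (A : Fm P R) : LindenbaumFm P R := Quotient.mk _ A

/-- The class of a resource term in the Lindenbaum algebra. -/
def Res.cls {R : Type u} (α : Res R) : LindenbaumRes R := Quotient.mk _ α

namespace LindenbaumRes

variable {R : Type u}

theorem ind {p : LindenbaumRes R → Prop} (h : ∀ α : Res R, p α.cls) (x : LindenbaumRes R) : p x :=
  Quotient.ind h x

instance : PartialOrder (LindenbaumRes R) where
  le := Quotient.lift₂ ResEntails fun _ _ _ _ h h' => propext
    ⟨fun H => h.2.trans (H.trans h'.1), fun H => h.1.trans (H.trans h'.2)⟩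
  le_refl := ind fun α => ResEntails.refl α
  le_trans := ind fun _ => ind fun _ => ind fun _ => ResEntails.trans
  le_antisymm := ind fun _ => ind fun _ => fun h h' => Quotient.sound ⟨h, h'⟩

theorem cls_le_cls {α β : Res R} : α.cls ≤ β.cls ↔ ResEntails α β := Iff.rfl

/-- Lift a binary connective that is monotone in each argument. -/
def map₂ (f : Res R → Res R → Res R)
    (hf : ∀ α α' β β', ResEntails α α' → ResEntails β β' → ResEntails (f α β) (f α' β')) :
    LindenbaumRes R → LindenbaumRes R → LindenbaumRes R :=
  Quotient.map₂ f fun _ _ h _ _ h' => ⟨hf _ _ _ _ h.1 h'.1, hf _ _ _ _ h.2 h'.2⟩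

instance : DistribLattice (LindenbaumRes R) where
  sup := map₂ .sup fun _ _ _ _ h h' => .sup_le (h.trans (.left_sup _ _)) (h'.trans (.right_sup _ _))
  inf := map₂ .inf fun _ _ _ _ h h' =>
    .le_inf (.trans (.inf_left _ _) h) (.trans (.inf_right _ _) h')
  le_sup_left := ind fun _ => ind fun _ => ResEntails.left_sup _ _
  le_sup_right := ind fun _ => ind fun _ => ResEntails.right_sup _ _
  sup_le := ind fun _ => ind fun _ => ind fun _ => ResEntails.sup_le
  inf_le_left := ind fun _ => ind fun _ => ResEntails.inf_left _ _
  inf_le_right := ind fun _ => ind fun _ => ResEntails.inf_right _ _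
  le_inf := ind fun _ => ind fun _ => ind fun _ => ResEntails.le_inf
  le_sup_inf := ind fun _ => ind fun _ => ind fun _ => ResEntails.R1_sup_inf _ _ _

instance : BoundedOrder (LindenbaumRes R) where
  top := Res.cls .one
  bot := Res.cls .zero
  le_top := ind fun _ => ResEntails.R3_one _
  bot_le := ind fun _ => ResEntails.R3_zero _

/-- The fusion of classes of resource terms. -/
def mul : LindenbaumRes R → LindenbaumRes R → LindenbaumRes R :=
  map₂ .mul fun _ _ _ _ h h' => .trans (.MF _ h) (.MF' _ h')

end LindenbaumRes

namespace LindenbaumFm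

variable {P R : Type u}

theorem ind {p : LindenbaumFm P R → Prop} (h : ∀ A : Fm P R, p A.cls) (x : LindenbaumFm P R) :
    p x :=
  Quotient.ind h x

instance : PartialOrder (LindenbaumFm P R) where
  le := Quotient.lift₂ (fun A B => Derives ∅ (.imp A B)) fun _ _ _ _ h h' => propext
    ⟨fun H => h.2.imp_trans (H.imp_trans h'.1), fun H => h.1.imp_trans (H.imp_trans h'.2)⟩
  le_refl := ind fun _ => Derives.imp_self
  le_trans := ind fun _ => ind fun _ => ind fun _ => Derives.imp_trans
  le_antisymm := ind fun _ => ind fun _ => fun h h' => Quotient.sound ⟨h, h'⟩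

theorem cls_le_cls {A B : Fm P R} : A.cls ≤ B.cls ↔ Derives ∅ (.imp A B) := Iff.rfl

theorem cls_eq_cls {A B : Fm P R} (h : Derives ∅ (A.iff B)) : A.cls = B.cls :=
  Quotient.sound ⟨h.and_left, h.and_right⟩

instance : HeytingAlgebra (LindenbaumFm P R) where
  sup := Quotient.map₂ .or fun _ _ h _ _ h' =>
    ⟨.or_elim (h.1.imp_trans (.ax (.or_left _ _))) (h'.1.imp_trans (.ax (.or_right _ _))),
      .or_elim (h.2.imp_trans (.ax (.or_left _ _))) (h'.2.imp_trans (.ax (.or_right _ _)))⟩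
  inf := Quotient.map₂ .and fun _ _ h _ _ h' =>
    ⟨.imp_and (.imp_trans (.ax (.and_left _ _)) h.1) (.imp_trans (.ax (.and_right _ _)) h'.1),
      .imp_and (.imp_trans (.ax (.and_left _ _)) h.2) (.imp_trans (.ax (.and_right _ _)) h'.2)⟩
  himp := Quotient.map₂ .imp fun _ _ h _ _ h' =>
    ⟨.imp_intro (h.2.of_empty.imp_trans (.imp_trans (.hyp (Or.inl rfl)) h'.1.of_empty)),
      .imp_intro (h.1.of_empty.imp_trans (.imp_trans (.hyp (Or.inl rfl)) h'.2.of_empty))⟩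
  top := Fm.cls .top
  bot := Fm.cls .bot
  compl := Quotient.map (fun A => .imp A .bot) fun _ _ h =>
    ⟨.imp_intro (h.2.of_empty.imp_trans (.hyp (Or.inl rfl))),
      .imp_intro (h.1.of_empty.imp_trans (.hyp (Or.inl rfl)))⟩
  le_sup_left := ind fun _ => ind fun _ => Derives.ax (.or_left _ _)
  le_sup_right := ind fun _ => ind fun _ => Derives.ax (.or_right _ _)
  sup_le := ind fun _ => ind fun _ => ind fun _ => Derives.or_elim
  inf_le_left := ind fun _ => ind fun _ => Derives.ax (.and_left _ _)
  inf_le_right := ind fun _ => ind fun _ => Derives.ax (.and_right _ _)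
  le_inf := ind fun _ => ind fun _ => ind fun _ => Derives.imp_and
  le_top := ind fun _ => Derives.const (.ax .top_intro)
  bot_le := ind fun _ => Derives.ax (.bot_elim _)
  le_himp_iff := ind fun _ => ind fun _ => ind fun _ => Derives.imp_imp_iff
  himp_bot := ind fun _ => rfl

end LindenbaumFm

/-- The Lindenbaum heterogeneous algebra of LRC. -/
def lindenbaum (P R : Type u) : HetAlgebra (LindenbaumFm P R) (LindenbaumRes R) where
  mul := LindenbaumRes.mul
  use := Quotient.map₂ .use fun _ _ h _ _ h' =>
    ⟨.imp_trans (.AB _ h.2) (.MB _ (Derives.singleton_iff.2 h'.1)),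
      .imp_trans (.AB _ h.1) (.MB _ (Derives.singleton_iff.2 h'.2))⟩
  dia := Quotient.map .dia fun _ _ h =>
    ⟨.MD (Derives.singleton_iff.2 h.1), .MD (Derives.singleton_iff.2 h.2)⟩
  have_ := Quotient.map .have_ fun _ _ h => ⟨.MD' h.1, .MD' h.2⟩
  get := Quotient.map₂ .get fun _ _ h _ _ h' =>
    ⟨.imp_trans (.AB' _ h.2) (.MB' _ h'.1), .imp_trans (.AB' _ h.1) (.MB' _ h'.2)⟩
  mul_assoc := LindenbaumRes.ind fun α => LindenbaumRes.ind fun β => LindenbaumRes.ind fun γ =>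
    Quotient.sound ⟨.R2_assoc α β γ, .R2_assoc' α β γ⟩
  top_mul := LindenbaumRes.ind fun α => Quotient.sound ⟨.R2_one_mul α, .R2_one_mul' α⟩
  mul_top := LindenbaumRes.ind fun α => Quotient.sound ⟨.R2_mul_one α, .R2_mul_one' α⟩
  mul_sup :=
    LindenbaumRes.ind fun α => LindenbaumRes.ind fun β => LindenbaumRes.ind fun γ =>
      Quotient.sound ⟨.R4_left α β γ,
        .sup_le (.MF' _ (.left_sup _ _)) (.MF' _ (.right_sup _ _))⟩
  sup_mul :=
    LindenbaumRes.ind fun α => LindenbaumRes.ind fun β => LindenbaumRes.ind fun γ =>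
      Quotient.sound ⟨.R4_right α β γ,
        .sup_le (.MF _ (.left_sup _ _)) (.MF _ (.right_sup _ _))⟩
  -- No clause makes `0` absorbing: `α · 0 ⊢ 1 · 0 ⊢ 0`, since `1` is both greatest and a unit.
  mul_bot := LindenbaumRes.ind fun α => Quotient.sound
    ⟨.trans (.MF _ (.R3_one α)) (.R2_one_mul _), .R3_zero _⟩
  bot_mul := LindenbaumRes.ind fun α => Quotient.sound
    ⟨.trans (.MF' _ (.R3_one α)) (.R2_mul_one _), .R3_zero _⟩
  D1 := LindenbaumFm.ind fun A => LindenbaumFm.ind fun B => LindenbaumFm.cls_eq_cls (.ax (.D1 A B))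
  D2 := LindenbaumFm.cls_eq_cls (.ax .D2)
  D3 :=
    LindenbaumRes.ind fun α => LindenbaumRes.ind fun β => LindenbaumFm.cls_eq_cls (.ax (.D3 α β))
  D4 := LindenbaumFm.cls_eq_cls (.ax .D4)
  B1 :=
    LindenbaumRes.ind fun α => LindenbaumRes.ind fun β => LindenbaumFm.ind fun A =>
      LindenbaumFm.cls_eq_cls (.ax (.B1 α β A))
  B2 := LindenbaumFm.ind fun A => Quotient.sound ⟨.const (.ax .top_intro), .const (.ax (.B2 A))⟩
  B3 :=
    LindenbaumRes.ind fun α => LindenbaumRes.ind fun β => LindenbaumFm.ind fun A =>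
      Derives.ax (.B3 α β A)
  B4 :=
    LindenbaumRes.ind fun α => LindenbaumRes.ind fun β => LindenbaumRes.ind fun γ =>
      LindenbaumFm.cls_eq_cls (.ax (.B4 α β γ))
  B5 := LindenbaumRes.ind fun α => Quotient.sound ⟨.const (.ax .top_intro), .const (.ax (.B5 α))⟩
  B6 :=
    LindenbaumRes.ind fun α => LindenbaumRes.ind fun β => LindenbaumRes.ind fun γ =>
      LindenbaumFm.cls_eq_cls (.ax (.B6 α β γ))
  B7 := LindenbaumRes.ind fun α => Quotient.sound ⟨.const (.ax .top_intro), .const (.ax (.B7 α))⟩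
  BD1 := LindenbaumRes.ind fun α => LindenbaumFm.ind fun A => Derives.ax (.BD1 α A)
  BD2 := LindenbaumRes.ind fun α => LindenbaumRes.ind fun β => Derives.ax (.BD2 α β)
  MF :=
    LindenbaumRes.ind fun _ => LindenbaumRes.ind fun _ => LindenbaumRes.ind fun γ => ResEntails.MF γ
  MF' :=
    LindenbaumRes.ind fun _ => LindenbaumRes.ind fun _ => LindenbaumRes.ind fun γ =>
      ResEntails.MF' γ
  MB := LindenbaumRes.ind fun α => LindenbaumFm.ind fun _ => LindenbaumFm.ind fun _ => fun h =>
    Derives.MB α (Derives.singleton_iff.2 h)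
  MD :=
    LindenbaumFm.ind fun _ => LindenbaumFm.ind fun _ => fun h =>
      Derives.MD (Derives.singleton_iff.2 h)
  AB :=
    LindenbaumRes.ind fun _ => LindenbaumRes.ind fun _ => LindenbaumFm.ind fun A => fun h =>
      Derives.AB A h
  MD' := LindenbaumRes.ind fun _ => LindenbaumRes.ind fun _ => fun h => Derives.MD' h
  MB' :=
    LindenbaumRes.ind fun _ => LindenbaumRes.ind fun _ => LindenbaumRes.ind fun γ => fun h =>
      Derives.MB' γ h
  AB' :=
    LindenbaumRes.ind fun _ => LindenbaumRes.ind fun _ => LindenbaumRes.ind fun γ => fun h =>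
      Derives.AB' γ h

theorem evalRes_lindenbaum {P R : Type u} (α : Res R) :
    (lindenbaum P R).evalRes (fun a => (Res.atom a).cls) α = α.cls := by
  induction α with
  | atom a => rfl
  | one => rfl
  | zero => rfl
  | mul α β hα hβ => rw [HetAlgebra.evalRes, hα, hβ]; rfl
  | sup α β hα hβ => rw [HetAlgebra.evalRes, hα, hβ]; rfl
  | inf α β hα hβ => rw [HetAlgebra.evalRes, hα, hβ]; rfl

theorem evalFm_lindenbaum {P R : Type u} (A : Fm P R) :
    (lindenbaum P R).evalFm (fun p => (Fm.atom p).cls) (fun a => (Res.atom a).cls) A = A.cls := by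
  induction A with
  | atom p => rfl
  | top => rfl
  | bot => rfl
  | or A B hA hB => rw [HetAlgebra.evalFm, hA, hB]; rfl
  | and A B hA hB => rw [HetAlgebra.evalFm, hA, hB]; rfl
  | imp A B hA hB => rw [HetAlgebra.evalFm, hA, hB]; rfl
  | use α A hA => rw [HetAlgebra.evalFm, hA, evalRes_lindenbaum]; rfl
  | dia A hA => rw [HetAlgebra.evalFm, hA]; rfl
  | have_ α => rw [HetAlgebra.evalFm, evalRes_lindenbaum]; rfl
  | get α β => rw [HetAlgebra.evalFm, evalRes_lindenbaum, evalRes_lindenbaum]; rfl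

/-! ### Strong completeness -/

/-- The classes of the consequences of `X` are closed under meets, and none lies below the class of
an underivable `A`; the separating prime filter is the countermodel point. No compactness argument
is needed for infinite `X`. -/
theorem Derives.of_perfectEntails {P R : Type u} {X : Set (Fm P R)} {A : Fm P R}
    (h : PerfectEntails X A) : Derives X A := by
  by_contra hA
  obtain ⟨w, hX, hw⟩ := PrimeFilter.exists_separating
    (F := {b | ∃ B : Fm P R, Derives X B ∧ b = B.cls}) (I := {A.cls})
    ⟨_, .top, .ax .top_intro, rfl⟩ ⟨_, rfl⟩
    (by
      rintro _ ⟨B, hB, rfl⟩ _ ⟨C, hC, rfl⟩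
      exact ⟨.and B C, hB.and_intro hC, rfl⟩)
    (by rintro _ rfl _ rfl; simp)
    (by
      rintro _ ⟨B, hB, rfl⟩ _ rfl hle
      exact hA (.mp (LindenbaumFm.cls_le_cls.1 hle).of_empty hB))
  have key := h _ _ (lindenbaum P R).canonicalExtension
    (lindenbaum P R).isPerfect_canonicalExtension (fun p => toCanonical (Fm.atom p).cls)
    (fun a => toCanonical (Res.atom a).cls)
  simp only [HetAlgebra.evalFm_canonicalExtension, evalFm_lindenbaum] at key
  -- Meets of lower sets are intersections, so `w` belongs to the meet over `X` as soon as it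
  -- contains every class from `X`.
  exact hw _ rfl (key (LowerSet.mem_iInf₂_iff.2 fun B hB => hX _ ⟨B, .hyp hB, rfl⟩))

theorem ResEntails.of_perfectResEntails {R : Type u} {α β : Res R}
    (h : PerfectResEntails α β) : ResEntails α β := by
  by_contra hαβ
  obtain ⟨w, hα, hβ⟩ := PrimeFilter.exists_separating (F := {α.cls}) (I := {β.cls})
    ⟨_, rfl⟩ ⟨_, rfl⟩ (by rintro _ rfl _ rfl; simp) (by rintro _ rfl _ rfl; simp)
    (by rintro _ rfl _ rfl hle; exact hαβ hle)
  -- Resource terms do not involve atomic propositions; `R` serves as an arbitrary type of them in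
  -- the right universe.
  have key := h _ _ (lindenbaum R R).canonicalExtension
    (lindenbaum R R).isPerfect_canonicalExtension (fun a => toCanonical (Res.atom a).cls)
  simp only [HetAlgebra.evalRes_canonicalExtension, evalRes_lindenbaum] at key
  exact hβ _ rfl (key (hα _ rfl))

end LRC

theorem mainTheorem3 {P R : Type u} :
    (∀ (X : Set (LRC.Fm P R)) (A : LRC.Fm P R),
      LRC.Derives X A ↔ LRC.PerfectEntails X A) ∧
    (∀ α β : LRC.Res R, LRC.ResEntails α β ↔ LRC.PerfectResEntails α β) :=
  ⟨fun _ _ => ⟨fun h _ _ _ _ F _ v w => h.sound F v w _ fun _ hB => iInf₂_le _ hB,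
    LRC.Derives.of_perfectEntails⟩,
    fun _ _ => ⟨fun h _ _ _ _ F _ w => h.sound F w, LRC.ResEntails.of_perfectResEntails⟩⟩
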